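/- **Setting.** Time is slotted, $k=0,1,2,\dots$. There are $N\ge 1$ contents, ranked by popularity; the content of rank $i$ has Zipf popularity $f_i=\frac{1/i^{v}}{\sum_{j=1}^N 1/j^{v}}$ with $v\ge 0$. In each slot a small-cell base station receives, with probability $p_u\in[0,1]$, one request, which is for the content of rank $i$ with probability $f_i$. In each slot, with probability $p_c\in(0,1]$, one of the $N$ contents, chosen uniformly at random, becomes outdated and is replaced by a new content, which enters with rank $N$ while the contents ranked below the removed one move up by one. The energy $A_k\ge 0$ harvested in slot $k$ has finite mean $\bar A$. Over the slots the harvested energies, the requests and the replacements are i.i.d., and the three are independent of each other. The state at the beginning of slot $k$ is $(E_k,C_k)$: the battery energy $E_k\ge0$, and the number $C_k\le N$ of pushed contents; the users hold the contents of rank $1,\dots,C_k$. A push costs energy $E_p>0$ and delivers the content of rank $C_k+1$ to all users; sleeping costs nothing. If $U_k\in\{0,E_p\}$ is the energy used, then $E_{k+1}=\min\{B_{\max},E_k-U_k+A_k\}$, where $B_{\max}\in(0,\infty]$ is the battery capacity. $C_{k+1}$ is $C_k$, plus $1$ if there is a push in slot $k$, minus $1$ if one of the $C_k$ contents of rank at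 most $C_k$ is replaced in slot $k$ (probability $p_cC_k/N$). A request in slot $k$ is blocked if its rank is larger than $C_k$ and the requested content is not being pushed in slot $k$ (the policies below never unicast). The long-run blocking probability is $\lim_{K\to\infty}\bar K/K$, where $\bar K$ is the number of blocked requests in the first $K$ slots. The push-only threshold-based (POTB) policy has the threshold $$C_{\mathrm{thr,PO}}=\min\Big\{N,\Big\lfloor\frac{(N+p_c)\bar A}{p_cE_p}\Big\rfloor\Big\},$$ and pushes in slot $k$ if $C_k<C_{\mathrm{thr,PO}}$ and $E_k\ge E_p$, and sleeps otherwise. **Theorem.** Put $p_{\mathrm{blk,PO}}=p_u\big(1-\sum_{i=1}^{C_{\mathrm{thr,PO}}}f_i\big)$. 1. For every finite $B_{\max}>0$ the long-run blocking probability of the POTB policy exists almost surely and is a constant $p(B_{\max})$, which does not depend on the initial state; and $p(B_{\max})\to p_{\mathrm{blk,PO}}$ as $B_{\max}\to\infty$. 2. With infinite battery capacity, the long-run blocking probability of the POTB policy is almost surely $p_{\mathrm{blk,PO}}$, for every initial state. 3. This is the same value as under an average power constraint. That is, suppose that every push can be powered, so that the policy with threshold $C\le N$ pushes if and only if $C_k<C$.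 With $C=C_{\mathrm{thr,PO}}$, almost surely, the average energy used per slot converges to $\frac{p_cC_{\mathrm{thr,PO}}}{N+p_c}E_p\le\bar A$ and the long-run blocking probability is $p_{\mathrm{blk,PO}}$. Moreover $p_{\mathrm{blk,PO}}$ is the minimum of the long-run blocking probabilities of such policies over all thresholds $C\in\{0,\dots,N\}$ for which the long-run average energy used per slot is at most $\bar A$. -/

import Mathlib

open MeasureTheory ProbabilityTheory Filter Topology

namespace PushPolicy

/-- Zipf popularity with skew `v` of the content of rank `i`, where `1 ≤ i ≤ N`. -/
noncomputable def zipf (N : ℕ) (v : ℝ) (i : ℕ) : ℝ :=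
  (1 / (i : ℝ) ^ v) / ∑ j ∈ Finset.Icc 1 N, 1 / (j : ℝ) ^ v

/-- The randomness of the system. In slot `k` the amount `A k` of energy is harvested, the content
of rank `J k` is requested (`J k = 0`: no request), and the content of rank `R k` is replaced by
a new one (`R k = 0`: no replacement). A request occurs with probability `pu` and asks for rank `i`
with probability `zipf N v i`; a replacement occurs with probability `pc` and the outdated content
is uniform among the `N` contents. The energy arrivals are nonnegative with mean `Abar`. Slots are
i.i.d., and arrival, request and replacement in a slot are independent. -/
structure IsSlotProcess {Ω : Type*} [MeasurableSpace Ω] (P : Measure Ω) (N : ℕ)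
    (pu pc v Abar : ℝ) (A : ℕ → Ω → ℝ) (J R : ℕ → Ω → ℕ) : Prop where
  measurable_arrival : ∀ k, Measurable (A k)
  measurable_request : ∀ k, Measurable (J k)
  measurable_replaced : ∀ k, Measurable (R k)
  arrival_nonneg : ∀ k ω, 0 ≤ A k ω
  arrival_identDistrib : ∀ k, IdentDistrib (A k) (A 0) P P
  arrival_integrable : Integrable (A 0) P
  arrival_mean : ∫ ω, A 0 ω ∂P = Abar
  request_none : ∀ k, P.real {ω | J k ω = 0} = 1 - pu
  request_rank : ∀ k, ∀ i ∈ Finset.Icc 1 N, P.real {ω | J k ω = i} = pu * zipf N v i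
  replaced_none : ∀ k, P.real {ω | R k ω = 0} = 1 - pc
  replaced_rank : ∀ k, ∀ i ∈ Finset.Icc 1 N, P.real {ω | R k ω = i} = pc * (1 / N)
  indep_slots : iIndepFun (fun k ω => (A k ω, J k ω, R k ω)) P
  indep_arrival : ∀ k, IndepFun (A k) (fun ω => (J k ω, R k ω)) P
  indep_request : ∀ k, IndepFun (J k) (R k) P

/-- The actions used by push-only policies. Unicast, the third action of the base station, is
never taken by them. -/
inductive Action where
  | sleep
  | push

/-- State at the beginning of a slot: the energy in the battery, and the number `pushed` of
contents stored by the users, which are the contents of rank `1, …, pushed`. -/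
structure State where
  energy : ℝ
  pushed : ℕ

/-- Energy used by an action; `Ep` is the energy needed to push one content. -/
def energyUse (Ep : ℝ) : Action → ℝ
  | .sleep => 0
  | .push => Ep

/-- Storing energy in a battery of capacity `B`, where `⊤` is infinite capacity. -/
noncomputable def store : WithTop ℝ → ℝ → ℝ
  | ⊤, x => x
  | (B : ℝ), x => min B x

/-- The number of pushed contents after a slot: it decreases by one if one of the contents
`1, …, C` held at the beginning of the slot is replaced, and increases by one after a push. -/
def nextPushed (C : ℕ) (u : Action) (r : ℕ) : ℕ :=
  let kept := if 1 ≤ r ∧ r ≤ C then C - 1 else C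
  match u with
  | .sleep => kept
  | .push => kept + 1

/-- One slot: action `u`, energy arrival `a`, replaced rank `r`. -/
noncomputable def step (B : WithTop ℝ) (Ep : ℝ) (s : State) (u : Action) (a : ℝ) (r : ℕ) : State :=
  ⟨store B (s.energy - energyUse Ep u + a), nextPushed s.pushed u r⟩

/-- State trajectory under the stationary policy `μ` from the initial state `s₀`. -/
noncomputable def trajectory (B : WithTop ℝ) (Ep : ℝ) (μ : State → Action) (s₀ : State)
    (a : ℕ → ℝ) (r : ℕ → ℕ) : ℕ → State
  | 0 => s₀
  | k + 1 =>
    step B Ep (trajectory B Ep μ s₀ a r k) (μ (trajectory B Ep μ s₀ a r k)) (a k) (r k)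

/-- The request `j` is blocked: there is a request for a content of rank `j > C`, which is not
transmitted in this slot; a push transmits the content of rank `C + 1`. -/
def Blocked (C : ℕ) (u : Action) (j : ℕ) : Prop :=
  C < j ∧ ¬ (u = Action.push ∧ j = C + 1)

open Classical in
/-- The number of blocked requests in the first `K` slots, divided by `K`. -/
noncomputable def blockedRatio (μ : State → Action) (s : ℕ → State) (j : ℕ → ℕ) (K : ℕ) : ℝ :=
  (((Finset.range K).filter fun k => Blocked (s k).pushed (μ (s k)) (j k)).card : ℝ) / K

/-- The average energy used per slot in the first `K` slots. -/
noncomputable def averagePower (Ep : ℝ) (μ : State → Action) (s : ℕ → State) (K : ℕ) : ℝ :=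
  (∑ k ∈ Finset.range K, energyUse Ep (μ (s k))) / K

/-- Push-only threshold-based policy with threshold `C`: push while fewer than `C` contents are
pushed and the battery holds the energy for a push, otherwise sleep. -/
noncomputable def thresholdPolicy (Ep : ℝ) (C : ℕ) (s : State) : Action :=
  if s.pushed < C ∧ Ep ≤ s.energy then .push else .sleep

/-- The same policy when every push can be powered, whatever the battery holds. -/
def unconstrainedPolicy (C : ℕ) (s : State) : Action :=
  if s.pushed < C then .push else .sleep

/-- The threshold of the push-only threshold-based (POTB) policy. -/
noncomputable def potbThreshold (N : ℕ) (pc Abar Ep : ℝ) : ℕ :=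
  min N ⌊((N : ℝ) + pc) * Abar / (pc * Ep)⌋₊

/-- `b` is the long-run blocking probability of some push-only threshold policy, with a threshold
at most `N`, that is subject only to the constraint that its long-run average power is at most
`Abar`. In `trajectory ⊤` the component `energy` may be negative here; it has no influence. -/
def IsAveragePowerBlocking {Ω : Type*} [MeasurableSpace Ω] (P : Measure Ω) (N : ℕ)
    (Ep Abar : ℝ) (A : ℕ → Ω → ℝ) (J R : ℕ → Ω → ℕ) (b : ℝ) : Prop :=
  ∃ C ≤ N, ∃ w ≤ Abar, ∀ s₀ : State, s₀.pushed ≤ N → ∀ᵐ ω ∂P,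
    Tendsto (averagePower Ep (unconstrainedPolicy C)
      (trajectory ⊤ Ep (unconstrainedPolicy C) s₀ (fun k => A k ω) (fun k => R k ω)))
      atTop (𝓝 w) ∧
    Tendsto (blockedRatio (unconstrainedPolicy C)
      (trajectory ⊤ Ep (unconstrainedPolicy C) s₀ (fun k => A k ω) (fun k => R k ω))
      (fun k => J k ω)) atTop (𝓝 b)

end PushPolicy

namespace PushPolicy

/-! Call `level` the number of stored contents plus one if a push is under way. A request is blocked
exactly when its rank exceeds the level, so by a strong law for functions of the state and fresh
noise the blocked ratio is asymptotically the average of `blockProb` along the levels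
(`tendsto_blockedRatio_sub`). The stored count is bounded, so pushes and losses balance:
asymptotically (N + pc) · (push rate) = pc · (mean level) (`tendsto_average_balance`). If every push
can be powered, the count settles between C - 1 and C and the level is eventually C. This gives
power and blocking for each threshold; the POTB threshold is the largest feasible one, and
`blockProb` is antitone.

With a battery the level eventually never exceeds C, so it suffices that the push rate is nearly ρ =
pc C / (N + pc). Feasibility gives only Ep ρ ≤ Abar, possibly with equality, so no upward drift of
the battery is available. Instead, fix a reference level b ≤ B, let w = shortfall / b, and split the
deficit Ep (ρ - push) of each slot with weights w and 1 - w. On the part w, the drift of shortfall²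
/ (2b) trades spent energy for arrivals, truncated at M because only their mean is finite. On the
part 1 - w, either the weight is O(1/b) because the battery is nearly empty, or the policy acts as
if every push were powered, and its deficit is covered by telescoping and martingale terms. The
long-run deficit is thus at most the mean lost by truncation plus O(1/b) (`deficit_le`,
`exists_deficit_le`, `eventually_abs_blockedRatio_sub_le`). For infinite capacity b is arbitrary;
for finite capacity b = B.

Existence of the limit for a fixed finite B uses regeneration: an atom is reached from the whole
operating region in boundedly many slots with probability bounded below, so the Poisson equation has
a bounded solution (`exists_poisson`) and the averages telescope. One boundary case, a single
content with deterministic arrivals, is treated directly. -/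

/-- The orbit of `x₀` under the random recursion `x ↦ F (x, z k)`. -/
def chain {S Ξ : Type*} (F : S × Ξ → S) (x₀ : S) (z : ℕ → Ξ) : ℕ → S
  | 0 => x₀
  | k + 1 => F (chain F x₀ z k, z k)

/-- A sequence with bounded increments is `o(k)` if it is so along the squares. -/
lemma tendsto_div_of_tendsto_div_sq {s : ℕ → ℝ} {c : ℝ} (hs : ∀ k, |s (k + 1) - s k| ≤ c)
    (h : Tendsto (fun n : ℕ => s (n ^ 2) / (n : ℝ) ^ 2) atTop (𝓝 0)) :
    Tendsto (fun k : ℕ => s k / k) atTop (𝓝 0) := by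
  have hc : 0 ≤ c := (abs_nonneg _).trans (hs 0)
  have hincr : ∀ m j : ℕ, |s (m + j) - s m| ≤ c * j := by
    intro m j
    induction j with
    | zero => simp
    | succ j ih =>
      have h1 := abs_add_le (s (m + j + 1) - s (m + j)) (s (m + j) - s m)
      have h2 := hs (m + j)
      rw [show s (m + j + 1) - s (m + j) + (s (m + j) - s m) = s (m + (j + 1)) - s m by
        rw [← add_assoc]; ring] at h1
      push_cast
      linarith
  have hsq : Tendsto Nat.sqrt atTop atTop :=
    tendsto_atTop.2 fun b => eventually_atTop.2 ⟨b * b, fun k hk => Nat.le_sqrt.2 hk⟩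
  have h1 : Tendsto (fun k : ℕ => |s (Nat.sqrt k ^ 2) / ((Nat.sqrt k : ℕ) : ℝ) ^ 2|
      + 2 * c / ((Nat.sqrt k : ℕ) : ℝ)) atTop (𝓝 0) := by
    have h2 : Tendsto (fun n : ℕ => |s (n ^ 2) / (n : ℝ) ^ 2| + 2 * c / (n : ℝ)) atTop (𝓝 0) := by
      simpa using h.abs.add (tendsto_const_div_atTop_nhds_zero_nat (2 * c))
    exact h2.comp hsq
  refine squeeze_zero_norm' ?_ h1
  filter_upwards [eventually_ge_atTop 1] with k hk
  set n := Nat.sqrt k with hn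
  have hn1 : 1 ≤ n := Nat.le_sqrt.2 (by simpa using hk)
  have hle : n ^ 2 ≤ k := Nat.sqrt_le' k
  -- Fewer than `2 * n + 1` steps separate `k` from the square below it, so the sequence moves by at
  -- most `2 * c * n`, which is negligible against `n ^ 2`.
  have hlt : k ≤ n ^ 2 + 2 * n := by have := Nat.sqrt_le_add k; rw [← hn] at this; nlinarith
  obtain ⟨j, hj⟩ := Nat.exists_eq_add_of_le hle
  have hj2 : (j : ℝ) ≤ 2 * n := by exact_mod_cast (by omega : j ≤ 2 * n)
  have h3 := hincr (n ^ 2) j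
  rw [← hj] at h3
  have hn0 : (0 : ℝ) < n := by exact_mod_cast hn1
  have hk0 : (0 : ℝ) < k := by exact_mod_cast hk
  have hkn : (n : ℝ) ^ 2 ≤ k := by exact_mod_cast hle
  have h4 : |s k| ≤ |s (n ^ 2)| + 2 * c * n := by
    have := abs_sub_abs_le_abs_sub (s k) (s (n ^ 2))
    nlinarith
  rw [Real.norm_eq_abs, abs_div, abs_div, abs_of_pos hk0, abs_of_nonneg (sq_nonneg (n : ℝ))]
  calc |s k| / k ≤ (|s (n ^ 2)| + 2 * c * n) / k := by gcongr
    _ ≤ (|s (n ^ 2)| + 2 * c * n) / (n : ℝ) ^ 2 := by gcongr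
    _ = |s (n ^ 2)| / (n : ℝ) ^ 2 + 2 * c / n := by field_simp

/-! ### Strong law for a recursion driven by i.i.d. noise. -/

section LawOfLargeNumbers

/-- The recursion `F` together with the running sum of `ψ`. -/
def accumulate {S Ξ : Type*} (F : S × Ξ → S) (ψ : S × Ξ → ℝ) (y : (S × ℝ) × Ξ) : S × ℝ :=
  (F (y.1.1, y.2), y.1.2 + ψ (y.1.1, y.2))

/-- State and partial sum together form an orbit of a recursion again, so `map_chain_prod` makes
them jointly independent of the next noise. -/
lemma chain_accumulate {S Ξ : Type*} (F : S × Ξ → S) (ψ : S × Ξ → ℝ) (x₀ : S) (z : ℕ → Ξ) (k : ℕ) :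
    chain (accumulate F ψ) (x₀, 0) z k =
      (chain F x₀ z k, ∑ i ∈ Finset.range k, ψ (chain F x₀ z i, z i)) := by
  induction k with
  | zero => simp [chain]
  | succ k ih => rw [Finset.sum_range_succ, chain, ih]; rfl

variable {S Ξ Ω : Type*} [MeasurableSpace S] [MeasurableSpace Ξ] {F : S × Ξ → S}
  {ξ : ℕ → Ω → Ξ} {ν : Measure Ξ}

lemma measurable_chain_past (hF : Measurable F) (x₀ : S) (k : ℕ) :
    Measurable[⨆ i ∈ Set.Iio k, MeasurableSpace.comap (ξ i) inferInstance]
      (fun ω => chain F x₀ (fun i => ξ i ω) k) := by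
  induction k with
  | zero => exact measurable_const
  | succ k ih =>
    have h1 : (⨆ i ∈ Set.Iio k, MeasurableSpace.comap (ξ i) inferInstance) ≤
        ⨆ i ∈ Set.Iio (k + 1), MeasurableSpace.comap (ξ i) inferInstance :=
      biSup_mono fun i hi => Nat.lt_succ_of_lt hi
    have h2 : MeasurableSpace.comap (ξ k) inferInstance ≤
        ⨆ i ∈ Set.Iio (k + 1), MeasurableSpace.comap (ξ i) inferInstance :=
      le_biSup (fun i => MeasurableSpace.comap (ξ i) inferInstance)
        (show k ∈ Set.Iio (k + 1) from Nat.lt_succ_self k)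
    exact hF.comp ((ih.mono h1 le_rfl).prodMk ((comap_measurable (ξ k)).mono h2 le_rfl))

variable [MeasurableSpace Ω] {P : Measure Ω}

lemma measurable_chain (hF : Measurable F) (hm : ∀ k, Measurable (ξ k)) (x₀ : S) (k : ℕ) :
    Measurable (fun ω => chain F x₀ (fun i => ξ i ω) k) :=
  (measurable_chain_past hF x₀ k).mono (iSup₂_le fun i _ => (hm i).comap_le) le_rfl

lemma indepFun_chain [IsProbabilityMeasure P] (hF : Measurable F) (hm : ∀ k, Measurable (ξ k))
    (hind : iIndepFun ξ P) (x₀ : S) (k : ℕ) :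
    IndepFun (fun ω => chain F x₀ (fun i => ξ i ω) k) (ξ k) P := by
  have h := indep_iSup_of_disjoint (fun i => (hm i).comap_le) hind
    (S := Set.Iio k) (T := {k}) (by simp)
  rw [IndepFun_iff_Indep]
  refine indep_of_indep_of_le_left (indep_of_indep_of_le_right h ?_)
    (measurable_chain_past hF x₀ k).comap_le
  simp

lemma map_chain_prod [IsProbabilityMeasure P] (hF : Measurable F) (hm : ∀ k, Measurable (ξ k))
    (hind : iIndepFun ξ P) (hν : ∀ k, P.map (ξ k) = ν) (x₀ : S) (k : ℕ) :
    P.map (fun ω => (chain F x₀ (fun i => ξ i ω) k, ξ k ω)) =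
      (P.map fun ω => chain F x₀ (fun i => ξ i ω) k).prod ν := by
  rw [← hν k]
  exact (indepFun_iff_map_prod_eq_prod_map_map (measurable_chain hF hm x₀ k).aemeasurable
    (hm k).aemeasurable).1 (indepFun_chain hF hm hind x₀ k)

variable [IsProbabilityMeasure P]

/-- The summands are martingale differences: integrating out the fresh noise gives zero for every
state and partial sum. The cross terms vanish, and `k` squares of size at most `c ^ 2` remain. -/
lemma integral_sq_sum_chain_le (hF : Measurable F) (hm : ∀ k, Measurable (ξ k))
    (hind : iIndepFun ξ P) (hν : ∀ k, P.map (ξ k) = ν) (x₀ : S) {ψ : S × Ξ → ℝ}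
    (hψ : Measurable ψ) {c : ℝ} (hc : ∀ y, |ψ y| ≤ c) (h0 : ∀ x, ∫ z, ψ (x, z) ∂ν = 0) (k : ℕ) :
    ∫ ω, (∑ i ∈ Finset.range k, ψ (chain F x₀ (fun i => ξ i ω) i, ξ i ω)) ^ 2 ∂P ≤ c ^ 2 * k := by
  have hν1 : IsProbabilityMeasure ν := hν 0 ▸ Measure.isProbabilityMeasure_map (hm 0).aemeasurable
  have hG : Measurable (accumulate F ψ) := by unfold accumulate; fun_prop
  set T : ℕ → Ω → ℝ := fun k ω => ∑ i ∈ Finset.range k, ψ (chain F x₀ (fun i => ξ i ω) i, ξ i ω)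
    with hT
  set D : ℕ → Ω → ℝ := fun k ω => ψ (chain F x₀ (fun i => ξ i ω) k, ξ k ω) with hD
  have hDm : ∀ k, Measurable (D k) := fun k =>
    hψ.comp ((measurable_chain hF hm x₀ k).prodMk (hm k))
  have hTm : ∀ k, Measurable (T k) := fun k => Finset.measurable_sum _ fun i _ => hDm i
  have hTb : ∀ k ω, |T k ω| ≤ c * k := by
    intro k ω
    refine (Finset.abs_sum_le_sum_abs _ _).trans ((Finset.sum_le_sum fun i _ => hc _).trans ?_)
    simp [mul_comm]
  have hc0 : 0 ≤ c := by
    have hne : Nonempty Ω := nonempty_of_isProbabilityMeasure P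
    exact (abs_nonneg _).trans (hc (x₀, ξ 0 hne.some))
  have hcross : ∀ k, ∫ ω, T k ω * D k ω ∂P = 0 := by
    intro k
    have h1 := map_chain_prod hG hm hind hν (x₀, (0 : ℝ)) k
    set Y : Ω → S × ℝ := fun ω => chain (accumulate F ψ) (x₀, 0) (fun i => ξ i ω) k with hY
    have hYm : Measurable Y := measurable_chain hG hm _ k
    have hYe : ∀ ω, Y ω = (chain F x₀ (fun i => ξ i ω) k, T k ω) := fun ω =>
      chain_accumulate F ψ x₀ _ k
    let q : (S × ℝ) × Ξ → ℝ := fun y => y.1.2 * ψ (y.1.1, y.2)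
    have hqm : Measurable q := by
      have : Measurable fun y : (S × ℝ) × Ξ => ψ (y.1.1, y.2) := by fun_prop
      fun_prop
    have h2 : ∫ ω, T k ω * D k ω ∂P = ∫ y, q y ∂((P.map Y).prod ν) := by
      rw [← h1, integral_map (hYm.prodMk (hm k)).aemeasurable hqm.aestronglyMeasurable]
      simp only [q, hYe, hD]
    have hint : Integrable q ((P.map Y).prod ν) := by
      rw [← h1, integrable_map_measure hqm.aestronglyMeasurable (hYm.prodMk (hm k)).aemeasurable]
      refine Integrable.of_bound (hqm.comp (hYm.prodMk (hm k))).aestronglyMeasurable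
        (c * k * c) (ae_of_all _ fun ω => ?_)
      simp only [q, hYe, Function.comp, norm_mul, Real.norm_eq_abs]
      exact mul_le_mul (hTb k ω) (hc _) (abs_nonneg _) (by positivity)
    rw [h2, integral_prod _ hint]
    simp [q, integral_const_mul, h0]
  have hTi : ∀ k, Integrable (fun ω => T k ω ^ 2) P := fun k =>
    Integrable.of_bound ((hTm k).pow_const 2).aestronglyMeasurable ((c * k) ^ 2)
      (ae_of_all _ fun ω => by
        rw [norm_pow, Real.norm_eq_abs]; exact pow_le_pow_left₀ (abs_nonneg _) (hTb k ω) 2)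
  have hDi : ∀ k, Integrable (fun ω => D k ω ^ 2) P := fun k =>
    Integrable.of_bound ((hDm k).pow_const 2).aestronglyMeasurable (c ^ 2)
      (ae_of_all _ fun ω => by
        rw [norm_pow, Real.norm_eq_abs]; exact pow_le_pow_left₀ (abs_nonneg _) (hc _) 2)
  have hTDi : ∀ k, Integrable (fun ω => T k ω * D k ω) P := fun k =>
    Integrable.of_bound ((hTm k).mul (hDm k)).aestronglyMeasurable (c * k * c)
      (ae_of_all _ fun ω => by
        rw [norm_mul, Real.norm_eq_abs, Real.norm_eq_abs]
        exact mul_le_mul (hTb k ω) (hc _) (abs_nonneg _) (by positivity))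
  change ∫ ω, T k ω ^ 2 ∂P ≤ c ^ 2 * k
  induction k with
  | zero => simp [hT]
  | succ k ih =>
    have e : ∀ ω, T (k + 1) ω ^ 2 = T k ω ^ 2 + 2 * (T k ω * D k ω) + D k ω ^ 2 := by
      intro ω
      have : T (k + 1) ω = T k ω + D k ω := Finset.sum_range_succ _ _
      rw [this]; ring
    have hD2 : ∫ ω, D k ω ^ 2 ∂P ≤ c ^ 2 := by
      have := integral_mono (hDi k) (integrable_const (c ^ 2)) fun ω =>
        sq_le_sq' (abs_le.1 (hc _)).1 (abs_le.1 (hc _)).2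
      simpa using this
    simp_rw [e]
    have hTD2 : Integrable (fun ω => T k ω ^ 2 + 2 * (T k ω * D k ω)) P :=
      (hTi k).add ((hTDi k).const_mul 2)
    rw [integral_add hTD2 (hDi k), integral_add (hTi k) ((hTDi k).const_mul 2),
      integral_const_mul, hcross]
    push_cast
    linarith

/-- Strong law for bounded centred functions of the state and of the fresh noise. -/
lemma tendsto_average_chain_of_centred (hF : Measurable F) (hm : ∀ k, Measurable (ξ k))
    (hind : iIndepFun ξ P) (hν : ∀ k, P.map (ξ k) = ν) (x₀ : S) {ψ : S × Ξ → ℝ}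
    (hψ : Measurable ψ) {c : ℝ} (hc : ∀ y, |ψ y| ≤ c) (h0 : ∀ x, ∫ z, ψ (x, z) ∂ν = 0) :
    ∀ᵐ ω ∂P, Tendsto (fun K : ℕ =>
      (∑ k ∈ Finset.range K, ψ (chain F x₀ (fun i => ξ i ω) k, ξ k ω)) / K) atTop (𝓝 0) := by
  set T : ℕ → Ω → ℝ := fun k ω => ∑ i ∈ Finset.range k, ψ (chain F x₀ (fun i => ξ i ω) i, ξ i ω)
    with hT
  have hTm : ∀ k, Measurable (T k) := fun k => Finset.measurable_sum _ fun i _ =>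
    hψ.comp ((measurable_chain hF hm x₀ i).prodMk (hm i))
  have hTb : ∀ k ω, |T k ω| ≤ c * k := by
    intro k ω
    refine (Finset.abs_sum_le_sum_abs _ _).trans ((Finset.sum_le_sum fun i _ => hc _).trans ?_)
    simp [mul_comm]
  have hTi : ∀ k, Integrable (fun ω => T k ω ^ 2) P := fun k =>
    Integrable.of_bound ((hTm k).pow_const 2).aestronglyMeasurable ((c * k) ^ 2)
      (ae_of_all _ fun ω => by
        rw [norm_pow, Real.norm_eq_abs]; exact pow_le_pow_left₀ (abs_nonneg _) (hTb k ω) 2)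
  -- Along the squares the normalised sums have second moments at most `c ^ 2 / n ^ 2`. These are
  -- summable, so the squared averages are almost surely summable and tend to zero.
  let u : ℕ → Ω → ENNReal := fun n ω => ENNReal.ofReal ((T (n ^ 2) ω / (n : ℝ) ^ 2) ^ 2)
  have hum : ∀ n, Measurable (u n) := fun n =>
    (((hTm _).div_const _).pow_const 2).ennreal_ofReal
  have hu : ∀ n, ∫⁻ ω, u n ω ∂P ≤ ENNReal.ofReal (c ^ 2 * (1 / (n : ℝ) ^ 2)) := by
    intro n
    have h1 : Integrable (fun ω => (T (n ^ 2) ω / (n : ℝ) ^ 2) ^ 2) P := by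
      simp_rw [div_pow]; exact (hTi _).div_const _
    rw [← ofReal_integral_eq_lintegral_ofReal h1 (ae_of_all _ fun ω => sq_nonneg _)]
    apply ENNReal.ofReal_le_ofReal
    simp_rw [div_pow]
    rw [integral_div]
    have h2 := integral_sq_sum_chain_le hF hm hind hν x₀ hψ hc h0 (n ^ 2)
    rcases Nat.eq_zero_or_pos n with rfl | hn
    · simp
    · have : (0 : ℝ) < n := by exact_mod_cast hn
      rw [div_le_iff₀ (by positivity)]
      refine h2.trans (le_of_eq ?_)
      push_cast; field_simp
  have hsum : ∑' n, ∫⁻ ω, u n ω ∂P ≠ ⊤ := by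
    refine ne_top_of_le_ne_top ?_ (ENNReal.tsum_le_tsum hu)
    have hs : Summable fun n : ℕ => c ^ 2 * (1 / (n : ℝ) ^ 2) :=
      (Real.summable_one_div_nat_pow.2 one_lt_two).mul_left _
    exact hs.tsum_ofReal_ne_top
  rw [← lintegral_tsum fun n => (hum n).aemeasurable] at hsum
  filter_upwards [ae_lt_top (Measurable.tsum hum) hsum] with ω hω
  refine tendsto_div_of_tendsto_div_sq (s := fun k => T k ω) (c := c) (fun k => ?_) ?_
  · simp only [hT, Finset.sum_range_succ, add_sub_cancel_left]; exact hc _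
  · have h1 := ENNReal.tendsto_atTop_zero_of_tsum_ne_top hω.ne
    have h2 := (ENNReal.tendsto_toReal ENNReal.zero_ne_top).comp h1
    have h3 : Tendsto (fun n : ℕ => (T (n ^ 2) ω / (n : ℝ) ^ 2) ^ 2) atTop (𝓝 0) := by
      refine h2.congr fun n => ?_
      simp [u, ENNReal.toReal_ofReal (sq_nonneg _)]
    have h4 := h3.sqrt
    simp only [Real.sqrt_sq_eq_abs, Real.sqrt_zero] at h4
    exact (tendsto_zero_iff_abs_tendsto_zero _).2 h4

/-- Strong law: averages of a bounded function of the state and of the fresh noise agree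
asymptotically with the averages of its one-step conditional mean. -/
theorem tendsto_average_chain (hF : Measurable F) (hm : ∀ k, Measurable (ξ k))
    (hind : iIndepFun ξ P) (hν : ∀ k, P.map (ξ k) = ν) (x₀ : S) {φ : S × Ξ → ℝ}
    (hφ : Measurable φ) {c : ℝ} (hc : ∀ y, |φ y| ≤ c) :
    ∀ᵐ ω ∂P, Tendsto (fun K : ℕ =>
      (∑ k ∈ Finset.range K, (φ (chain F x₀ (fun i => ξ i ω) k, ξ k ω) -
        ∫ z, φ (chain F x₀ (fun i => ξ i ω) k, z) ∂ν)) / K) atTop (𝓝 0) := by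
  have hν1 : IsProbabilityMeasure ν := hν 0 ▸ Measure.isProbabilityMeasure_map (hm 0).aemeasurable
  have hI : Measurable fun x => ∫ z, φ (x, z) ∂ν :=
    (hφ.stronglyMeasurable.integral_prod_right').measurable
  have hb : ∀ x, |∫ z, φ (x, z) ∂ν| ≤ c := fun x => by
    simpa using norm_integral_le_of_norm_le_const (μ := ν) (f := fun z => φ (x, z)) (C := c)
      (ae_of_all _ fun z => hc _)
  have hint : ∀ x, Integrable (fun z => φ (x, z)) ν := fun x =>
    Integrable.of_bound (hφ.comp measurable_prodMk_left).aestronglyMeasurable c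
      (ae_of_all _ fun z => hc _)
  refine tendsto_average_chain_of_centred hF hm hind hν x₀
    (ψ := fun y => φ y - ∫ z, φ (y.1, z) ∂ν) (c := c + c)
    (hφ.sub (hI.comp measurable_fst)) (fun y => ?_) (fun x => ?_)
  · exact (abs_sub _ _).trans (add_le_add (hc _) (hb _))
  · simp only
    rw [integral_sub (hint x) (integrable_const _)]
    simp

end LawOfLargeNumbers

/-! ### Poisson equation from the Green function of the recursion killed at an atom. -/

section Poisson

variable {S Ξ : Type*} [MeasurableSpace S] [MeasurableSpace Ξ] {ν : Measure Ξ}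
  {F : S × Ξ → S} {W : Set S}

/-- The one-step operator of the recursion `F`, killed outside `W`. -/
noncomputable def killed (ν : Measure Ξ) (F : S × Ξ → S) (W : Set S) (h : S → ENNReal) (x : S) :
    ENNReal :=
  ∫⁻ z, W.indicator h (F (x, z)) ∂ν

omit [MeasurableSpace S] in
lemma killed_mono {g h : S → ENNReal} (hgh : ∀ y ∈ W, g y ≤ h y) (x : S) :
    killed ν F W g x ≤ killed ν F W h x := by
  refine lintegral_mono fun z => ?_
  by_cases hz : F (x, z) ∈ W
  · simpa [hz] using hgh _ hz
  · simp [hz]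

lemma measurable_killed [SFinite ν] (hF : Measurable F) (hW : MeasurableSet W) {h : S → ENNReal}
    (hh : Measurable h) : Measurable (killed ν F W h) :=
  Measurable.lintegral_prod_right' ((hh.indicator hW).comp hF)

lemma measurable_iterate_killed [SFinite ν] (hF : Measurable F) (hW : MeasurableSet W)
    {h : S → ENNReal} (hh : Measurable h) (n : ℕ) : Measurable ((killed ν F W)^[n] h) := by
  induction n with
  | zero => exact hh
  | succ n ih => rw [Function.iterate_succ_apply']; exact measurable_killed hF hW ih

lemma killed_const_mul (hF : Measurable F) (hW : MeasurableSet W) (a : ENNReal) {h : S → ENNReal}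
    (hh : Measurable h) (x : S) :
    killed ν F W (fun y => a * h y) x = a * killed ν F W h x := by
  unfold killed
  rw [← lintegral_const_mul a (f := fun z => W.indicator h (F (x, z)))
    ((hh.indicator hW).comp (hF.comp measurable_prodMk_left))]
  refine lintegral_congr fun z => ?_
  by_cases hz : F (x, z) ∈ W <;> simp [hz]

lemma killed_tsum (hF : Measurable F) (hW : MeasurableSet W) {h : ℕ → S → ENNReal}
    (hh : ∀ n, Measurable (h n)) (x : S) :
    killed ν F W (fun y => ∑' n, h n y) x = ∑' n, killed ν F W (h n) x := by
  unfold killed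
  rw [← lintegral_tsum (f := fun n z => W.indicator (h n) (F (x, z))) fun n =>
    (((hh n).indicator hW).comp (hF.comp measurable_prodMk_left)).aemeasurable]
  refine lintegral_congr fun z => ?_
  by_cases hz : F (x, z) ∈ W <;> simp [hz]

/-- The Green function of the killed recursion. -/
noncomputable def green (ν : Measure Ξ) (F : S × Ξ → S) (W : Set S) (h : S → ENNReal) (x : S) :
    ENNReal :=
  ∑' n, (killed ν F W)^[n] h x

lemma measurable_green [SFinite ν] (hF : Measurable F) (hW : MeasurableSet W) {h : S → ENNReal}
    (hh : Measurable h) : Measurable (green ν F W h) :=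
  Measurable.tsum fun n => measurable_iterate_killed hF hW hh n

/-- First-step decomposition. For `W = D \ {a}` with `D` closed under the recursion, the Green
function is the expected cost collected until the next visit to `a`; for `h = 1` it is the expected
duration. -/
lemma green_eq [SFinite ν] (hF : Measurable F) (hW : MeasurableSet W) {h : S → ENNReal}
    (hh : Measurable h) (x : S) :
    green ν F W h x = h x + killed ν F W (green ν F W h) x := by
  unfold green
  rw [killed_tsum hF hW fun n => measurable_iterate_killed hF hW hh n,
    tsum_eq_zero_add' ENNReal.summable]
  simp only [Function.iterate_succ_apply', Function.iterate_zero, id]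

omit [MeasurableSpace S] in
lemma iterate_killed_mono {g h : S → ENNReal} (hgh : ∀ y, g y ≤ h y) (n : ℕ) (x : S) :
    (killed ν F W)^[n] g x ≤ (killed ν F W)^[n] h x := by
  induction n generalizing x with
  | zero => exact hgh x
  | succ n ih =>
    rw [Function.iterate_succ_apply', Function.iterate_succ_apply']
    exact killed_mono (fun y _ => ih y) x

omit [MeasurableSpace S] in
lemma green_mono {g h : S → ENNReal} (hgh : ∀ y, g y ≤ h y) (x : S) :
    green ν F W g x ≤ green ν F W h x :=
  ENNReal.tsum_le_tsum fun n => iterate_killed_mono hgh n x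

variable [IsProbabilityMeasure ν]

omit [MeasurableSpace S] in
lemma iterate_killed_one_le (n : ℕ) (x : S) : (killed ν F W)^[n] 1 x ≤ 1 := by
  induction n generalizing x with
  | zero => exact le_rfl
  | succ n ih =>
    rw [Function.iterate_succ_apply']
    calc killed ν F W ((killed ν F W)^[n] 1) x ≤ ∫⁻ _, 1 ∂ν := by
          refine lintegral_mono fun z => ?_
          by_cases hz : F (x, z) ∈ W
          · simpa [hz] using ih _
          · simp [hz]
      _ = 1 := by simp

/-- If noise in `G` leads to the atom `a` or lowers the rank, then the atom is reached within `n`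
steps with probability at least `ν G ^ n` from each state of rank below `n`. -/
lemma iterate_killed_add_pow_le {D : Set S} {a : S} (hF : Measurable F) (hD : MeasurableSet D)
    (ha : MeasurableSet {a}) {G : Set Ξ} (hG : MeasurableSet G) {ρ : S → ℕ}
    (hρ : ∀ x ∈ D, ∀ z ∈ G, F (x, z) = a ∨ F (x, z) ∈ D ∧ ρ (F (x, z)) < ρ x)
    (n : ℕ) (x : S) (hx : x ∈ D) (hn : ρ x < n) :
    (killed ν F (D \ {a}))^[n] 1 x + ν G ^ n ≤ 1 := by
  induction n generalizing x with
  | zero => exact absurd hn (Nat.not_lt_zero _)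
  | succ n ih =>
    rw [Function.iterate_succ_apply']
    set u := (killed ν F (D \ {a}))^[n] 1 with hu
    have hum : Measurable u := measurable_iterate_killed hF (hD.diff ha) measurable_one n
    have hp : ν G ^ n ≤ 1 := pow_le_one₀ zero_le prob_le_one
    have e : ν G ^ (n + 1) = ∫⁻ z, G.indicator (fun _ => ν G ^ n) z ∂ν := by
      rw [lintegral_indicator_const hG, pow_succ]
    rw [e, killed, ← lintegral_add_left (f := fun z => (D \ {a}).indicator u (F (x, z)))
      ((hum.indicator (hD.diff ha)).comp (hF.comp measurable_prodMk_left))]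
    calc _ ≤ ∫⁻ _, 1 ∂ν := by
          refine lintegral_mono fun z => ?_
          by_cases hz : z ∈ G
          · rcases hρ x hx z hz with h | ⟨h1, h2⟩
            · simp [hz, h, hp]
            · by_cases h3 : F (x, z) = a
              · simp [hz, h3, hp]
              · have := ih _ h1 (by omega)
                simpa [hz, h1, h3] using this
          · by_cases h3 : F (x, z) ∈ D \ {a}
            · simpa [hz, h3] using iterate_killed_one_le n _
            · simp [hz, h3]
      _ = 1 := by simp

/-- Survival for `m` steps has probability at most `θ = 1 - ν G ^ m` everywhere on `D`. Each partial
sum `T` of survival probabilities therefore satisfies `T ≤ m + θ * T`; partial sums are finite, so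
`T` can be cancelled. -/
lemma green_one_le {D : Set S} {a : S} (hF : Measurable F) (hD : MeasurableSet D)
    (ha : MeasurableSet {a}) {G : Set Ξ} (hG : MeasurableSet G) (hG0 : ν G ≠ 0) {ρ : S → ℕ} {m : ℕ}
    (hρ : ∀ x ∈ D, ∀ z ∈ G, F (x, z) = a ∨ F (x, z) ∈ D ∧ ρ (F (x, z)) < ρ x)
    (hm : ∀ x ∈ D, ρ x < m) (x : S) (hx : x ∈ D) :
    green ν F (D \ {a}) 1 x ≤ m / ν G ^ m := by
  set K := killed ν F (D \ {a}) with hK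
  have hp0 : ν G ^ m ≠ 0 := pow_ne_zero _ hG0
  have hp1 : ν G ^ m ≤ 1 := pow_le_one₀ zero_le prob_le_one
  set θ := 1 - ν G ^ m with hθ
  have hθp : θ + ν G ^ m = 1 := tsub_add_cancel_of_le hp1
  have h1 : ∀ y ∈ D, K^[m] 1 y ≤ θ := fun y hy =>
    ENNReal.le_sub_of_add_le_right (ne_top_of_le_ne_top ENNReal.one_ne_top hp1)
      (iterate_killed_add_pow_le hF hD ha hG hρ m y hy (hm y hy))
  have h2 : ∀ n, ∀ y ∈ D, K^[n + m] 1 y ≤ θ * K^[n] 1 y := by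
    intro n
    induction n with
    | zero => intro y hy; simpa using h1 y hy
    | succ n ih =>
      intro y hy
      rw [show n + 1 + m = (n + m) + 1 by ring, Function.iterate_succ_apply',
        Function.iterate_succ_apply']
      refine (killed_mono (fun w hw => ih w hw.1) y).trans (le_of_eq ?_)
      exact killed_const_mul hF (hD.diff ha) θ
        (measurable_iterate_killed hF (hD.diff ha) measurable_one n) y
  have hle1 : ∀ n, K^[n] 1 x ≤ 1 := fun n => iterate_killed_one_le n x
  refine ENNReal.tsum_le_of_sum_range_le fun M => ?_
  set T := ∑ n ∈ Finset.range M, K^[n] 1 x with hT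
  have hTtop : T ≠ ⊤ := by
    refine ne_top_of_le_ne_top (b := (M : ENNReal)) (ENNReal.natCast_ne_top _) ?_
    refine (Finset.sum_le_sum fun n _ => hle1 n).trans ?_
    simp
  have h3 : T ≤ m + θ * T := by
    calc T ≤ ∑ n ∈ Finset.range (m + M), K^[n] 1 x :=
          Finset.sum_le_sum_of_subset (Finset.range_mono (by omega))
      _ = ∑ n ∈ Finset.range m, K^[n] 1 x + ∑ n ∈ Finset.range M, K^[m + n] 1 x :=
          Finset.sum_range_add _ _ _
      _ ≤ m + θ * T := by
          gcongr
          · refine (Finset.sum_le_sum fun n _ => hle1 n).trans ?_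
            simp
          · rw [hT, Finset.mul_sum]
            exact Finset.sum_le_sum fun n _ => by rw [add_comm m n]; exact h2 n x hx
  rw [ENNReal.le_div_iff_mul_le (Or.inl hp0)
    (Or.inl (ne_top_of_le_ne_top ENNReal.one_ne_top hp1))]
  have h4 : T + T * ν G ^ m ≤ T + m := by
    calc T + T * ν G ^ m ≤ m + θ * T + T * ν G ^ m := by gcongr
      _ = (θ + ν G ^ m) * T + m := by ring
      _ = T + m := by rw [hθp, one_mul]
  exact (ENNReal.add_le_add_iff_left hTtop).1 h4

/-- Solution of the Poisson equation on a closed region in which an atom is reached, from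
everywhere, with positive probability in a bounded number of steps. -/
theorem exists_poisson {D : Set S} {a : S} (hF : Measurable F) (hD : MeasurableSet D)
    (ha : MeasurableSet {a}) (haD : a ∈ D) (hclosed : ∀ x ∈ D, ∀ᵐ z ∂ν, F (x, z) ∈ D)
    {G : Set Ξ} (hG : MeasurableSet G) (hG0 : ν G ≠ 0) {ρ : S → ℕ} {m : ℕ}
    (hρ : ∀ x ∈ D, ∀ z ∈ G, F (x, z) = a ∨ F (x, z) ∈ D ∧ ρ (F (x, z)) < ρ x)
    (hm : ∀ x ∈ D, ρ x < m) {f : S → ℝ} (hf : Measurable f) (hf0 : ∀ x, 0 ≤ f x)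
    (hf1 : ∀ x, f x ≤ 1) :
    ∃ (c : ℝ) (h : S → ℝ) (b : ℝ), Measurable h ∧ (∀ x, |h x| ≤ b) ∧
      ∀ x ∈ D, f x - c = h x - ∫ z, h (F (x, z)) ∂ν := by
  set W := D \ {a} with hWdef
  have hW : MeasurableSet W := hD.diff ha
  set f' : S → ENNReal := fun x => ENNReal.ofReal (f x) with hf'
  have hf'm : Measurable f' := hf.ennreal_ofReal
  have hf'1 : ∀ x, f' x ≤ (1 : S → ENNReal) x := fun x => by simpa [hf'] using hf1 x
  set g := green ν F W f' with hg
  set e := green ν F W 1 with he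
  have hgm : Measurable g := measurable_green hF hW hf'm
  have hem : Measurable e := measurable_green hF hW measurable_one
  set b : ENNReal := m / ν G ^ m with hb
  have hbtop : b ≠ ⊤ := ENNReal.div_ne_top (ENNReal.natCast_ne_top _) (pow_ne_zero _ hG0)
  have heb : ∀ x ∈ D, e x ≤ b := fun x hx => green_one_le hF hD ha hG hG0 hρ hm x hx
  have hgb : ∀ x ∈ D, g x ≤ b := fun x hx => (green_mono hf'1 x).trans (heb x hx)
  have hbr : ∀ q : S → ENNReal, (∀ x ∈ D, q x ≤ b) → ∀ x ∈ D, |(q x).toReal| ≤ b.toReal := by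
    intro q hq x hx
    rw [abs_of_nonneg ENNReal.toReal_nonneg]
    exact ENNReal.toReal_mono hbtop (hq x hx)
  -- Mean cost per step over a cycle from `a` to `a`. With this value `g - c * e` vanishes at `a`,
  -- so killing there removes nothing and the first-step equations of `g` and `e` combine to the
  -- Poisson equation.
  set c := (g a).toReal / (e a).toReal with hc
  have hea : 0 < (e a).toReal := by
    refine ENNReal.toReal_pos ?_ (ne_top_of_le_ne_top hbtop (heb a haD))
    rw [he, green_eq hF hW measurable_one]
    simp
  set h : S → ℝ := D.indicator fun x => (g x).toReal - c * (e x).toReal with hh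
  refine ⟨c, h, b.toReal + |c| * b.toReal, (hgm.ennreal_toReal.sub
    (hem.ennreal_toReal.const_mul c)).indicator hD, fun x => ?_, fun x hx => ?_⟩
  · by_cases hx : x ∈ D
    · simp only [hh, Set.indicator_of_mem hx]
      refine (abs_sub _ _).trans ?_
      rw [abs_mul]
      gcongr
      · exact hbr g hgb x hx
      · exact hbr e heb x hx
    · simp only [hh, Set.indicator_of_notMem hx, abs_zero]
      positivity
  · have hint : ∀ q : S → ENNReal, Measurable q → (∀ x ∈ D, q x ≤ b) →
        Integrable (fun z => (W.indicator q (F (x, z))).toReal) ν ∧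
        ∫ z, (W.indicator q (F (x, z))).toReal ∂ν = (killed ν F W q x).toReal := by
      intro q hqm hq
      have hqW : ∀ y, W.indicator q y ≤ b := fun y => by
        by_cases hy : y ∈ W
        · simpa [hy] using hq y hy.1
        · simp [hy]
      have hmeas : Measurable fun z => W.indicator q (F (x, z)) :=
        (hqm.indicator hW).comp (hF.comp measurable_prodMk_left)
      constructor
      · refine Integrable.of_bound hmeas.ennreal_toReal.aestronglyMeasurable b.toReal
          (ae_of_all _ fun z => ?_)
        rw [Real.norm_eq_abs, abs_of_nonneg ENNReal.toReal_nonneg]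
        exact ENNReal.toReal_mono hbtop (hqW _)
      · rw [integral_toReal hmeas.aemeasurable
          (ae_of_all _ fun z => (hqW _).trans_lt hbtop.lt_top), killed]
    have h1 : ∀ᵐ z ∂ν, h (F (x, z)) =
        (W.indicator g (F (x, z))).toReal - c * (W.indicator e (F (x, z))).toReal := by
      filter_upwards [hclosed x hx] with z hz
      by_cases h2 : F (x, z) = a
      · have h3 : (g a).toReal - c * (e a).toReal = 0 := by rw [hc]; field_simp; ring
        simp [hh, h2, haD, hWdef, h3]
      · simp [hh, hz, hWdef, h2]
    rw [integral_congr_ae h1, integral_sub (hint g hgm hgb).1 ((hint e hem heb).1.const_mul c),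
      integral_const_mul, (hint g hgm hgb).2, (hint e hem heb).2]
    have key : ∀ q r : S → ENNReal, (∀ x, q x = r x + killed ν F W q x) → (∀ x ∈ D, q x ≤ b) →
        (q x).toReal = (r x).toReal + (killed ν F W q x).toReal := by
      intro q r hqr hq
      have h4 : q x ≠ ⊤ := ne_top_of_le_ne_top hbtop (hq x hx)
      rw [hqr x] at h4
      rw [← ENNReal.toReal_add (ENNReal.add_ne_top.1 h4).1 (ENNReal.add_ne_top.1 h4).2, ← hqr x]
    have k1 := key g f' (green_eq hF hW hf'm) hgb
    have k2 := key e 1 (green_eq hF hW measurable_one) heb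
    simp only [hf', ENNReal.toReal_ofReal (hf0 x), Pi.one_apply, ENNReal.toReal_one] at k1 k2
    simp only [hh, Set.indicator_of_mem hx]
    linear_combination c * k2 - k1

end Poisson

/-! ### Zipf weights and the blocking probability of a level. -/

section Zipf

variable {N : ℕ} {v : ℝ}

lemma zipf_nonneg (i : ℕ) : 0 ≤ zipf N v i := by unfold zipf; positivity

lemma sum_zipf (hN : 1 ≤ N) : ∑ i ∈ Finset.Icc 1 N, zipf N v i = 1 := by
  unfold zipf
  rw [← Finset.sum_div, div_self]
  refine (Finset.sum_pos (fun i hi => ?_) ⟨1, by simp [hN]⟩).ne'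
  have : (0 : ℝ) < i := by exact_mod_cast (Finset.mem_Icc.1 hi).1
  positivity

/-- The probability that a request arrives and its rank exceeds `d`. -/
noncomputable def blockProb (N : ℕ) (pu v : ℝ) (d : ℕ) : ℝ :=
  pu * (1 - ∑ i ∈ Finset.Icc 1 d, zipf N v i)

lemma blockProb_zero (N : ℕ) (pu v : ℝ) : blockProb N pu v 0 = pu := by simp [blockProb]

lemma blockProb_anti {pu : ℝ} (hpu : 0 ≤ pu) {c d : ℕ} (h : c ≤ d) :
    blockProb N pu v d ≤ blockProb N pu v c := by
  unfold blockProb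
  have : ∑ i ∈ Finset.Icc 1 c, zipf N v i ≤ ∑ i ∈ Finset.Icc 1 d, zipf N v i :=
    Finset.sum_le_sum_of_subset_of_nonneg (Finset.Icc_subset_Icc le_rfl h)
      fun i _ _ => zipf_nonneg i
  gcongr

lemma blockProb_mem_Icc (hN : 1 ≤ N) {pu : ℝ} (hpu : pu ∈ Set.Icc (0 : ℝ) 1) {d : ℕ} (hd : d ≤ N) :
    blockProb N pu v d ∈ Set.Icc (0 : ℝ) 1 := by
  constructor
  · have h := blockProb_anti (v := v) (N := N) hpu.1 hd
    rwa [blockProb, sum_zipf hN, sub_self, mul_zero] at h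
  · have h := blockProb_anti (v := v) (N := N) hpu.1 (Nat.zero_le d)
    rw [blockProb_zero] at h
    exact h.trans hpu.2

end Zipf

/-- The prescribed masses of requests and replacements at `0, …, N` already add up to one, which
leaves nothing for larger ranks. Hence these masses determine the law. -/
lemma real_singleton_eq_zero_of_sum {m : Measure ℕ} [IsProbabilityMeasure m] {N : ℕ}
    (h : ∑ i ∈ Finset.range (N + 1), m.real {i} = 1) {i : ℕ} (hi : N < i) : m.real {i} = 0 := by
  have h1 : m.real (↑(insert i (Finset.range (N + 1))) : Set ℕ) ≤ 1 := measureReal_le_one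
  rw [← sum_measureReal_singleton, Finset.sum_insert (by simp; omega), h] at h1
  have := measureReal_nonneg (μ := m) (s := {i})
  linarith

lemma measure_eq_of_real_singleton {m m' : Measure ℕ} [IsProbabilityMeasure m]
    [IsProbabilityMeasure m'] {N : ℕ} (h : ∑ i ∈ Finset.range (N + 1), m.real {i} = 1)
    (hmm : ∀ i ≤ N, m.real {i} = m'.real {i}) : m = m' := by
  have h' : ∑ i ∈ Finset.range (N + 1), m'.real {i} = 1 := by
    rw [← h]
    exact Finset.sum_congr rfl fun i hi => (hmm i (by simpa [Nat.lt_succ_iff] using hi)).symm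
  refine Measure.ext_of_singleton fun i => ?_
  rw [← measureReal_eq_measureReal_iff]
  rcases le_or_gt i N with hi | hi
  · exact hmm i hi
  · rw [real_singleton_eq_zero_of_sum h hi, real_singleton_eq_zero_of_sum h' hi]

/-! ### The law of a slot. -/

section SlotProcess

variable {Ω : Type*} [MeasurableSpace Ω] {P : Measure Ω} {N : ℕ} {pu pc v Abar : ℝ}
  {A : ℕ → Ω → ℝ} {J R : ℕ → Ω → ℕ}

/-- Energy arrival, request and replacement of a slot. -/
def slot {Ω : Type*} (A : ℕ → Ω → ℝ) (J R : ℕ → Ω → ℕ) (k : ℕ) (ω : Ω) : ℝ × ℕ × ℕ :=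
  (A k ω, J k ω, R k ω)

/-- The law of a slot. -/
noncomputable def slotLaw {Ω : Type*} [MeasurableSpace Ω] (P : Measure Ω) (A : ℕ → Ω → ℝ)
    (J R : ℕ → Ω → ℕ) : Measure (ℝ × ℕ × ℕ) :=
  P.map (slot A J R 0)

namespace IsSlotProcess

lemma measurable_slot (hX : IsSlotProcess P N pu pc v Abar A J R) (k : ℕ) :
    Measurable (slot A J R k) :=
  (hX.measurable_arrival k).prodMk ((hX.measurable_request k).prodMk (hX.measurable_replaced k))

lemma arrival_mean_nonneg (hX : IsSlotProcess P N pu pc v Abar A J R) : 0 ≤ Abar :=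
  hX.arrival_mean ▸ integral_nonneg fun ω => hX.arrival_nonneg 0 ω

lemma sum_request (hX : IsSlotProcess P N pu pc v Abar A J R) (hN : 1 ≤ N) (k : ℕ) :
    ∑ i ∈ Finset.range (N + 1), (P.map (J k)).real {i} = 1 := by
  have e : ∀ i, (P.map (J k)).real {i} = P.real {ω | J k ω = i} := fun i =>
    map_measureReal_apply (hX.measurable_request k) (measurableSet_singleton i)
  simp_rw [e]
  rw [Finset.range_eq_Ico, Finset.sum_eq_sum_Ico_succ_bot (Nat.succ_pos N), hX.request_none]
  have h : Finset.Ico (0 + 1) (N + 1) = Finset.Icc 1 N := by ext; simp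
  rw [h, Finset.sum_congr rfl (hX.request_rank k), ← Finset.mul_sum, sum_zipf hN]
  ring

lemma sum_replaced (hX : IsSlotProcess P N pu pc v Abar A J R) (hN : 1 ≤ N) (k : ℕ) :
    ∑ i ∈ Finset.range (N + 1), (P.map (R k)).real {i} = 1 := by
  have e : ∀ i, (P.map (R k)).real {i} = P.real {ω | R k ω = i} := fun i =>
    map_measureReal_apply (hX.measurable_replaced k) (measurableSet_singleton i)
  simp_rw [e]
  rw [Finset.range_eq_Ico, Finset.sum_eq_sum_Ico_succ_bot (Nat.succ_pos N), hX.replaced_none]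
  have h : Finset.Ico (0 + 1) (N + 1) = Finset.Icc 1 N := by ext; simp
  have : (N : ℝ) ≠ 0 := by positivity
  rw [h, Finset.sum_congr rfl (hX.replaced_rank k)]
  simp
  field_simp
  ring

variable [IsProbabilityMeasure P]

lemma map_slot_eq_prod (hX : IsSlotProcess P N pu pc v Abar A J R) (k : ℕ) :
    P.map (slot A J R k) = (P.map (A k)).prod ((P.map (J k)).prod (P.map (R k))) := by
  rw [← (indepFun_iff_map_prod_eq_prod_map_map (hX.measurable_request k).aemeasurable
      (hX.measurable_replaced k).aemeasurable).1 (hX.indep_request k),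
    ← (indepFun_iff_map_prod_eq_prod_map_map (hX.measurable_arrival k).aemeasurable
      ((hX.measurable_request k).prodMk (hX.measurable_replaced k)).aemeasurable).1
      (hX.indep_arrival k)]
  rfl

lemma map_request (hX : IsSlotProcess P N pu pc v Abar A J R) (hN : 1 ≤ N) (k : ℕ) :
    P.map (J k) = P.map (J 0) := by
  have := Measure.isProbabilityMeasure_map (μ := P) (hX.measurable_request k).aemeasurable
  have := Measure.isProbabilityMeasure_map (μ := P) (hX.measurable_request 0).aemeasurable
  refine measure_eq_of_real_singleton (hX.sum_request hN k) fun i hi => ?_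
  rw [map_measureReal_apply (hX.measurable_request k) (measurableSet_singleton i),
    map_measureReal_apply (hX.measurable_request 0) (measurableSet_singleton i)]
  change P.real {ω | J k ω = i} = P.real {ω | J 0 ω = i}
  rcases Nat.eq_zero_or_pos i with rfl | h
  · rw [hX.request_none, hX.request_none]
  · rw [hX.request_rank k i (Finset.mem_Icc.2 ⟨h, hi⟩),
      hX.request_rank 0 i (Finset.mem_Icc.2 ⟨h, hi⟩)]

lemma map_replaced (hX : IsSlotProcess P N pu pc v Abar A J R) (hN : 1 ≤ N) (k : ℕ) :
    P.map (R k) = P.map (R 0) := by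
  have := Measure.isProbabilityMeasure_map (μ := P) (hX.measurable_replaced k).aemeasurable
  have := Measure.isProbabilityMeasure_map (μ := P) (hX.measurable_replaced 0).aemeasurable
  refine measure_eq_of_real_singleton (hX.sum_replaced hN k) fun i hi => ?_
  rw [map_measureReal_apply (hX.measurable_replaced k) (measurableSet_singleton i),
    map_measureReal_apply (hX.measurable_replaced 0) (measurableSet_singleton i)]
  change P.real {ω | R k ω = i} = P.real {ω | R 0 ω = i}
  rcases Nat.eq_zero_or_pos i with rfl | h
  · rw [hX.replaced_none, hX.replaced_none]
  · rw [hX.replaced_rank k i (Finset.mem_Icc.2 ⟨h, hi⟩),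
      hX.replaced_rank 0 i (Finset.mem_Icc.2 ⟨h, hi⟩)]

/-- Only the arrivals are assumed identically distributed. Requests and replacements inherit it from
their prescribed masses, and independence within a slot assembles the joint law. -/
lemma map_slot (hX : IsSlotProcess P N pu pc v Abar A J R) (hN : 1 ≤ N) (k : ℕ) :
    P.map (slot A J R k) = slotLaw P A J R := by
  rw [slotLaw, hX.map_slot_eq_prod, hX.map_slot_eq_prod, hX.map_request hN k,
    hX.map_replaced hN k, (hX.arrival_identDistrib k).map_eq]

lemma isProbabilityMeasure_slotLaw (hX : IsSlotProcess P N pu pc v Abar A J R) :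
    IsProbabilityMeasure (slotLaw P A J R) :=
  Measure.isProbabilityMeasure_map (hX.measurable_slot 0).aemeasurable

lemma request_gt (hX : IsSlotProcess P N pu pc v Abar A J R) {d : ℕ} (hd : d ≤ N) :
    P.real {ω | d < J 0 ω} = blockProb N pu v d := by
  have e : ∀ i, (P.map (J 0)).real {i} = P.real {ω | J 0 ω = i} := fun i =>
    map_measureReal_apply (hX.measurable_request 0) (measurableSet_singleton i)
  have h1 : P.real (J 0 ⁻¹' ↑(Finset.range (d + 1))) =
      ∑ i ∈ Finset.range (d + 1), P.real {ω | J 0 ω = i} := by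
    rw [← map_measureReal_apply (hX.measurable_request 0) (Finset.measurableSet _),
      ← sum_measureReal_singleton]
    exact Finset.sum_congr rfl fun i _ => e i
  have h2 : {ω | d < J 0 ω} = (J 0 ⁻¹' ↑(Finset.range (d + 1)))ᶜ := by
    ext ω; simp
  rw [h2, probReal_compl_eq_one_sub (hX.measurable_request 0 (Finset.measurableSet _)), h1,
    Finset.range_eq_Ico, Finset.sum_eq_sum_Ico_succ_bot (Nat.succ_pos d), hX.request_none]
  have h : Finset.Ico (0 + 1) (d + 1) = Finset.Icc 1 d := by ext; simp
  rw [h, Finset.sum_congr rfl fun i hi => hX.request_rank 0 i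
    (Finset.Icc_subset_Icc le_rfl hd hi), ← Finset.mul_sum, blockProb]
  ring

lemma replaced_mem_Icc (hX : IsSlotProcess P N pu pc v Abar A J R) {c : ℕ} (hc : c ≤ N) :
    P.real {ω | 1 ≤ R 0 ω ∧ R 0 ω ≤ c} = pc * c / N := by
  have e : ∀ i, (P.map (R 0)).real {i} = P.real {ω | R 0 ω = i} := fun i =>
    map_measureReal_apply (hX.measurable_replaced 0) (measurableSet_singleton i)
  have h1 : P.real (R 0 ⁻¹' ↑(Finset.Icc 1 c)) =
      ∑ i ∈ Finset.Icc 1 c, P.real {ω | R 0 ω = i} := by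
    rw [← map_measureReal_apply (hX.measurable_replaced 0) (Finset.measurableSet _),
      ← sum_measureReal_singleton]
    exact Finset.sum_congr rfl fun i _ => e i
  have h2 : {ω | 1 ≤ R 0 ω ∧ R 0 ω ≤ c} = R 0 ⁻¹' ↑(Finset.Icc 1 c) := by ext ω; simp
  rw [h2, h1, Finset.sum_congr rfl fun i hi => hX.replaced_rank 0 i
    (Finset.Icc_subset_Icc le_rfl hc hi)]
  simp
  ring

lemma slotLaw_request_gt (hX : IsSlotProcess P N pu pc v Abar A J R) {d : ℕ}
    (hd : d ≤ N) : (slotLaw P A J R).real {z | d < z.2.1} = blockProb N pu v d := by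
  rw [← hX.request_gt hd, slotLaw, map_measureReal_apply (hX.measurable_slot 0)]
  · rfl
  · exact measurableSet_lt measurable_const (by fun_prop)

lemma measurableSet_hit (c : ℕ) :
    MeasurableSet {z : ℝ × ℕ × ℕ | 1 ≤ z.2.2 ∧ z.2.2 ≤ c} :=
  (measurable_snd.comp measurable_snd)
    (MeasurableSet.of_discrete (s := {r : ℕ | 1 ≤ r ∧ r ≤ c}))

lemma slotLaw_hit (hX : IsSlotProcess P N pu pc v Abar A J R) {c : ℕ} (hc : c ≤ N) :
    (slotLaw P A J R).real {z | 1 ≤ z.2.2 ∧ z.2.2 ≤ c} = pc * c / N := by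
  rw [← hX.replaced_mem_Icc hc, slotLaw, map_measureReal_apply (hX.measurable_slot 0)
    (measurableSet_hit c)]
  rfl

lemma measurableSet_arrival_replaced {a : Set ℝ} (ha : MeasurableSet a) (r : Set ℕ) :
    MeasurableSet {z : ℝ × ℕ × ℕ | z.1 ∈ a ∧ z.2.2 ∈ r} :=
  (measurable_fst ha).inter ((measurable_snd.comp measurable_snd)
    (MeasurableSet.of_discrete (s := r)))

omit [IsProbabilityMeasure P] in
-- Independence of arrival and replacement keeps a joint requirement on them possible. Such events
-- are the favourable noise that drives the state to an atom.
lemma slotLaw_arrival_replaced (hX : IsSlotProcess P N pu pc v Abar A J R) {a : Set ℝ} {r : Set ℕ}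
    (ha : MeasurableSet a) (hA : P (A 0 ⁻¹' a) ≠ 0) (hR : P (R 0 ⁻¹' r) ≠ 0) :
    slotLaw P A J R {z | z.1 ∈ a ∧ z.2.2 ∈ r} ≠ 0 := by
  have h1 : slotLaw P A J R {z | z.1 ∈ a ∧ z.2.2 ∈ r} = P (A 0 ⁻¹' a) * P (R 0 ⁻¹' r) := by
    rw [slotLaw, Measure.map_apply (hX.measurable_slot 0) (measurableSet_arrival_replaced ha r)]
    exact ((hX.indep_arrival 0).comp measurable_id measurable_snd).measure_inter_preimage_eq_mul
      a r ha MeasurableSet.of_discrete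
  rw [h1]
  exact mul_ne_zero hA hR

omit [IsProbabilityMeasure P] in
lemma slotLaw_arrival_nonneg (hX : IsSlotProcess P N pu pc v Abar A J R) :
    ∀ᵐ z ∂slotLaw P A J R, 0 ≤ z.1 := by
  rw [slotLaw, ae_map_iff (hX.measurable_slot 0).aemeasurable
    (measurableSet_le measurable_const measurable_fst)]
  exact ae_of_all _ fun ω => hX.arrival_nonneg 0 ω

omit [IsProbabilityMeasure P] in
/-- Strong law for functions of the energy arrivals. -/
lemma tendsto_average_arrival (hX : IsSlotProcess P N pu pc v Abar A J R) {φ : ℝ → ℝ}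
    (hφ : Measurable φ) (hi : Integrable (fun ω => φ (A 0 ω)) P) :
    ∀ᵐ ω ∂P, Tendsto (fun K : ℕ => (∑ k ∈ Finset.range K, φ (A k ω)) / K) atTop
      (𝓝 (∫ ω, φ (A 0 ω) ∂P)) := by
  refine strong_law_ae_real (fun k ω => φ (A k ω)) hi (fun i j hij => ?_) fun i => ?_
  · exact (hX.indep_slots.indepFun hij).comp (hφ.comp measurable_fst) (hφ.comp measurable_fst)
  · exact (hX.arrival_identDistrib i).comp hφ

/-- Each rank is replaced infinitely often. -/
lemma frequently_replaced (hX : IsSlotProcess P N pu pc v Abar A J R) (hN : 1 ≤ N) (hpc : 0 < pc)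
    {i : ℕ} (hi : i ∈ Finset.Icc 1 N) : ∀ᵐ ω ∂P, ∃ᶠ k in atTop, R k ω = i := by
  have hms : ∀ k, MeasurableSet {ω | R k ω = i} := fun k =>
    hX.measurable_replaced k (measurableSet_singleton i)
  have hind : iIndepSet (fun k => {ω | R k ω = i}) P := by
    rw [iIndepSet_iff_meas_biInter hms]
    intro T
    have h := hX.indep_slots.comp (fun _ z => z.2.2) fun _ => by fun_prop
    exact h.measure_inter_preimage_eq_mul
      T (sets := fun _ => {i}) fun _ _ => measurableSet_singleton i
  have hp : ∀ k, P {ω | R k ω = i} = ENNReal.ofReal (pc * (1 / N)) := fun k => by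
    rw [← hX.replaced_rank k i hi, ofReal_measureReal]
  have hpos : ENNReal.ofReal (pc * (1 / N)) ≠ 0 := by
    have : (0 : ℝ) < N := by exact_mod_cast hN
    simp only [ne_eq, ENNReal.ofReal_eq_zero, not_le]
    positivity
  have h := measure_limsup_eq_one hms hind (by
    simp_rw [hp]; exact ENNReal.tsum_const_eq_top_of_ne_zero hpos)
  have h2 := (mem_ae_iff_prob_eq_one (MeasurableSet.measurableSet_limsup hms)).2 h
  filter_upwards [h2] with ω hω
  exact (mem_limsup_iff_frequently_mem (s := fun k => {ω | R k ω = i}) (𝓕 := atTop) (a := ω)).1 hω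

end IsSlotProcess

end SlotProcess

/-! ### The model as a measurable recursion. -/

section Model

instance : MeasurableSpace State :=
  MeasurableSpace.comap (fun s => (s.energy, s.pushed)) inferInstance

lemma measurable_energy : Measurable State.energy :=
  measurable_fst.comp (comap_measurable fun s : State => (s.energy, s.pushed))

lemma measurable_pushed : Measurable State.pushed :=
  measurable_snd.comp (comap_measurable fun s : State => (s.energy, s.pushed))

lemma measurable_state_mk {α : Type*} [MeasurableSpace α] {e : α → ℝ} {c : α → ℕ}
    (he : Measurable e) (hc : Measurable c) : Measurable fun x => (⟨e x, c x⟩ : State) :=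
  measurable_comap_iff.2 (he.prodMk hc)

lemma measurableSet_singleton_state (a : State) : MeasurableSet {a} := by
  have : ({a} : Set State) = State.energy ⁻¹' {a.energy} ∩ State.pushed ⁻¹' {a.pushed} := by
    ext s
    cases a
    cases s
    simp
  rw [this]
  exact (measurable_energy (measurableSet_singleton _)).inter
    (measurable_pushed (measurableSet_singleton _))

instance : MeasurableSpace Action := ⊤

instance : DiscreteMeasurableSpace Action := ⟨fun _ => trivial⟩

/-- The number of contents pushed by an action. -/
def pushes : Action → ℕ
  | .sleep => 0
  | .push => 1

lemma pushes_le_one (u : Action) : pushes u ≤ 1 := by cases u <;> simp [pushes]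

lemma energyUse_eq (Ep : ℝ) (u : Action) : energyUse Ep u = Ep * pushes u := by
  cases u <;> simp [energyUse, pushes]

instance : Countable Action := by
  refine ⟨pushes, fun u w h => ?_⟩
  cases u <;> cases w <;> simp_all [pushes]

/-- Indicator that a replacement of rank `r` removes one of the first `c` contents. -/
def hit (c r : ℕ) : ℝ := if 1 ≤ r ∧ r ≤ c then 1 else 0

lemma hit_nonneg (c r : ℕ) : 0 ≤ hit c r := by unfold hit; split_ifs <;> norm_num

lemma hit_le_one (c r : ℕ) : hit c r ≤ 1 := by unfold hit; split_ifs <;> norm_num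

/-- A hit needs `1 ≤ r ≤ c`, so the natural subtraction in `nextPushed` never truncates. -/
lemma nextPushed_cast (c : ℕ) (u : Action) (r : ℕ) :
    (nextPushed c u r : ℝ) = c - hit c r + pushes u := by
  have h : ((if 1 ≤ r ∧ r ≤ c then c - 1 else c : ℕ) : ℝ) = c - hit c r := by
    unfold hit
    split_ifs with h
    · rw [Nat.cast_sub (h.1.trans h.2)]; simp
    · simp
  cases u
  · simp only [nextPushed, pushes, h]; simp
  · simp only [nextPushed, pushes]; push_cast [h]; simp

lemma nextPushed_le (c : ℕ) (u : Action) (r : ℕ) : nextPushed c u r ≤ c + pushes u := by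
  have h1 := nextPushed_cast c u r
  have h2 := hit_nonneg c r
  have : (nextPushed c u r : ℝ) ≤ ((c + pushes u : ℕ) : ℝ) := by push_cast; linarith
  exact_mod_cast this

lemma blocked_iff (c : ℕ) (u : Action) (j : ℕ) : Blocked c u j ↔ c + pushes u < j := by
  unfold Blocked
  cases u
  · simp [pushes]
  · simp [pushes]; omega

lemma measurable_store (B : WithTop ℝ) : Measurable (store B) := by
  cases B with
  | top => exact measurable_id
  | coe B => exact measurable_const.min measurable_id

/-- One slot as a function of the state and of the randomness of the slot. -/
noncomputable def slotStep (B : WithTop ℝ) (Ep : ℝ) (μ : State → Action)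
    (y : State × (ℝ × ℕ × ℕ)) : State :=
  step B Ep y.1 (μ y.1) y.2.1 y.2.2.2

lemma measurable_slotStep (B : WithTop ℝ) (Ep : ℝ) {μ : State → Action} (hμ : Measurable μ) :
    Measurable (slotStep B Ep μ) := by
  have h1 : Measurable fun y : State × (ℝ × ℕ × ℕ) => y.1.energy :=
    measurable_energy.comp measurable_fst
  have h2 : Measurable fun y : State × (ℝ × ℕ × ℕ) => y.1.pushed :=
    measurable_pushed.comp measurable_fst
  have h3 : Measurable fun y : State × (ℝ × ℕ × ℕ) => μ y.1 := hμ.comp measurable_fst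
  have h4 : Measurable (energyUse Ep) := Measurable.of_discrete
  have h5 : Measurable fun w : ℕ × Action × ℕ => nextPushed w.1 w.2.1 w.2.2 :=
    Measurable.of_discrete
  refine measurable_state_mk ((measurable_store B).comp ((h1.sub (h4.comp h3)).add ?_))
    (h5.comp (h2.prodMk (h3.prodMk ?_)))
  · fun_prop
  · fun_prop

/-- The state trajectory as a function of the sample point. -/
noncomputable abbrev path {Ω : Type*} (B : WithTop ℝ) (Ep : ℝ) (μ : State → Action) (s₀ : State)
    (A : ℕ → Ω → ℝ) (R : ℕ → Ω → ℕ) (ω : Ω) : ℕ → State :=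
  trajectory B Ep μ s₀ (fun k => A k ω) (fun k => R k ω)

lemma path_eq_chain {Ω : Type*} (B : WithTop ℝ) (Ep : ℝ) (μ : State → Action) (s₀ : State)
    (A : ℕ → Ω → ℝ) (J R : ℕ → Ω → ℕ) (ω : Ω) (k : ℕ) :
    path B Ep μ s₀ A R ω k = chain (slotStep B Ep μ) s₀ (fun i => slot A J R i ω) k := by
  induction k with
  | zero => rfl
  | succ k ih =>
    change step B Ep (path B Ep μ s₀ A R ω k) (μ (path B Ep μ s₀ A R ω k)) (A k ω) (R k ω) = _
    rw [ih]
    rfl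

/-- The contents of rank up to `level μ s` are delivered without being blocked. -/
def level (μ : State → Action) (s : State) : ℕ := s.pushed + pushes (μ s)

lemma measurable_level {μ : State → Action} (hμ : Measurable μ) : Measurable (level μ) :=
  measurable_pushed.add ((Measurable.of_discrete (f := pushes)).comp hμ)

lemma trajectory_pushed_succ_le (B : WithTop ℝ) (Ep : ℝ) (μ : State → Action) (s₀ : State)
    (a : ℕ → ℝ) (r : ℕ → ℕ) (k : ℕ) :
    (trajectory B Ep μ s₀ a r (k + 1)).pushed ≤ level μ (trajectory B Ep μ s₀ a r k) :=
  nextPushed_le _ _ _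

lemma trajectory_pushed_le {B : WithTop ℝ} {Ep : ℝ} {μ : State → Action} {N : ℕ}
    (hlev : ∀ s : State, s.pushed ≤ N → level μ s ≤ N) {s₀ : State} (hs : s₀.pushed ≤ N)
    (a : ℕ → ℝ) (r : ℕ → ℕ) (k : ℕ) : (trajectory B Ep μ s₀ a r k).pushed ≤ N := by
  induction k with
  | zero => exact hs
  | succ k ih => exact (trajectory_pushed_succ_le B Ep μ s₀ a r k).trans (hlev _ ih)

lemma averagePower_eq (Ep : ℝ) (μ : State → Action) (s : ℕ → State) (K : ℕ) :
    averagePower Ep μ s K = Ep * ((∑ k ∈ Finset.range K, (pushes (μ (s k)) : ℝ)) / K) := by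
  unfold averagePower
  simp_rw [energyUse_eq, ← Finset.mul_sum]
  ring

lemma blockedRatio_eq (μ : State → Action) (s : ℕ → State) (j : ℕ → ℕ) (K : ℕ) :
    blockedRatio μ s j K =
      (∑ k ∈ Finset.range K, if level μ (s k) < j k then (1 : ℝ) else 0) / K := by
  unfold blockedRatio
  simp_rw [blocked_iff]
  rw [Finset.sum_boole]
  congr!

end Model

/-! ### Long-run averages along a path. -/

section Averages

variable {Ω : Type*} [MeasurableSpace Ω] {P : Measure Ω} [IsProbabilityMeasure P] {N : ℕ}
  {pu pc v Abar : ℝ} {A : ℕ → Ω → ℝ} {J R : ℕ → Ω → ℕ} {B : WithTop ℝ} {Ep : ℝ}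
  {μ : State → Action} {s₀ : State}

lemma tendsto_average_path (hX : IsSlotProcess P N pu pc v Abar A J R) (hN : 1 ≤ N)
    (hμ : Measurable μ) (s₀ : State) {φ : State × (ℝ × ℕ × ℕ) → ℝ} (hφ : Measurable φ) {c : ℝ}
    (hc : ∀ y, |φ y| ≤ c) :
    ∀ᵐ ω ∂P, Tendsto (fun K : ℕ =>
      (∑ k ∈ Finset.range K, (φ (path B Ep μ s₀ A R ω k, slot A J R k ω) -
        ∫ z, φ (path B Ep μ s₀ A R ω k, z) ∂slotLaw P A J R)) / K) atTop (𝓝 0) := by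
  have := tendsto_average_chain (measurable_slotStep B Ep hμ) hX.measurable_slot hX.indep_slots
    (hX.map_slot hN) s₀ hφ hc
  simp_rw [path_eq_chain B Ep μ s₀ A J R]
  exact this

/-- The long-run blocking probability is the average of `blockProb` along the levels. -/
lemma tendsto_blockedRatio_sub (hX : IsSlotProcess P N pu pc v Abar A J R) (hN : 1 ≤ N)
    (hμ : Measurable μ) (hlev : ∀ s : State, s.pushed ≤ N → level μ s ≤ N)
    (hs : s₀.pushed ≤ N) :
    ∀ᵐ ω ∂P, Tendsto (fun K : ℕ =>
      blockedRatio μ (path B Ep μ s₀ A R ω) (fun k => J k ω) K -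
      (∑ k ∈ Finset.range K, blockProb N pu v (level μ (path B Ep μ s₀ A R ω k))) / K)
      atTop (𝓝 0) := by
  have hset : MeasurableSet {y : State × (ℝ × ℕ × ℕ) | level μ y.1 < y.2.2.1} :=
    measurableSet_lt ((measurable_level hμ).comp measurable_fst) (by fun_prop)
  have h := tendsto_average_path (B := B) (Ep := Ep) hX hN hμ s₀
    (φ := fun y => if level μ y.1 < y.2.2.1 then 1 else 0)
    (Measurable.ite hset measurable_const measurable_const) (c := 1)
    (fun y => by split_ifs <;> simp)
  filter_upwards [h] with ω hω
  refine hω.congr fun K => ?_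
  rw [blockedRatio_eq, ← sub_div, ← Finset.sum_sub_distrib]
  congr 1
  refine Finset.sum_congr rfl fun k _ => ?_
  have hl := hlev _ (trajectory_pushed_le (B := B) (Ep := Ep) hlev hs (fun k => A k ω)
    (fun k => R k ω) k)
  have hI : ∀ d ≤ N, ∫ z, (if d < z.2.1 then (1 : ℝ) else 0) ∂slotLaw P A J R =
      blockProb N pu v d := fun d hd => by
    rw [← hX.slotLaw_request_gt hd, ← integral_indicator_one
      (measurableSet_lt measurable_const (by fun_prop))]
    simp [Set.indicator_apply]
  rw [← hI _ hl]
  rfl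

/-- Replacements that hit a pushed content occur at the rate `pc * pushed / N`, also when weighted
by a bounded function of the state. -/
lemma tendsto_average_hit (hX : IsSlotProcess P N pu pc v Abar A J R) (hN : 1 ≤ N)
    (hμ : Measurable μ) (hlev : ∀ s : State, s.pushed ≤ N → level μ s ≤ N)
    (hs : s₀.pushed ≤ N) {w : State → ℝ} (hw : Measurable w) {c : ℝ} (hc : ∀ s, |w s| ≤ c) :
    ∀ᵐ ω ∂P, Tendsto (fun K : ℕ => (∑ k ∈ Finset.range K, w (path B Ep μ s₀ A R ω k) *
      (hit (path B Ep μ s₀ A R ω k).pushed (R k ω) -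
        pc * (path B Ep μ s₀ A R ω k).pushed / N)) / K) atTop (𝓝 0) := by
  have hhit : Measurable fun y : ℕ × ℕ => hit y.1 y.2 := Measurable.of_discrete
  have h := tendsto_average_path (B := B) (Ep := Ep) hX hN hμ s₀
    (φ := fun y => w y.1 * hit y.1.pushed y.2.2.2)
    ((hw.comp measurable_fst).mul (hhit.comp ((measurable_pushed.comp measurable_fst).prodMk
      (by fun_prop)))) (c := c) (fun y => by
        rw [abs_mul, abs_of_nonneg (hit_nonneg _ _)]
        exact (mul_le_of_le_one_right (abs_nonneg _) (hit_le_one _ _)).trans (hc _))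
  filter_upwards [h] with ω hω
  refine hω.congr fun K => ?_
  congr 1
  refine Finset.sum_congr rfl fun k _ => ?_
  have hl := trajectory_pushed_le (B := B) (Ep := Ep) hlev hs (fun k => A k ω)
    (fun k => R k ω) k
  simp only [slot]
  have hI : ∀ d ≤ N, ∫ z, hit d z.2.2 ∂slotLaw P A J R = pc * d / N := fun d hd => by
    rw [← hX.slotLaw_hit hd, ← integral_indicator_one (IsSlotProcess.measurableSet_hit _)]
    simp [Set.indicator_apply, hit]
  rw [integral_const_mul, mul_sub, hI _ hl]

lemma tendsto_bounded_div {u : ℕ → ℝ} {b : ℝ} (hu : ∀ k, |u k| ≤ b) :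
    Tendsto (fun K : ℕ => u K / K) atTop (𝓝 0) := by
  refine squeeze_zero_norm (fun K => ?_) (tendsto_const_div_atTop_nhds_zero_nat b)
  rw [norm_div, Real.norm_eq_abs, Real.norm_natCast]
  gcongr
  exact hu K

/-- Balance of pushes and replacements. -/
lemma tendsto_average_balance (hX : IsSlotProcess P N pu pc v Abar A J R) (hN : 1 ≤ N)
    (hμ : Measurable μ) (hlev : ∀ s : State, s.pushed ≤ N → level μ s ≤ N)
    (hs : s₀.pushed ≤ N) :
    ∀ᵐ ω ∂P, Tendsto (fun K : ℕ => (∑ k ∈ Finset.range K,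
      ((N + pc) * (pushes (μ (path B Ep μ s₀ A R ω k)) : ℝ) -
        pc * level μ (path B Ep μ s₀ A R ω k))) / K) atTop (𝓝 0) := by
  filter_upwards [tendsto_average_hit (B := B) (Ep := Ep) hX hN hμ hlev hs
    (w := fun _ => 1) measurable_const (c := 1) (by simp)] with ω hω
  set X := path B Ep μ s₀ A R ω with hXdef
  have hb : ∀ k, |((X k).pushed : ℝ) - (X 0).pushed| ≤ N := by
    intro k
    have h1 := trajectory_pushed_le (B := B) (Ep := Ep) hlev hs (fun k => A k ω)
      (fun k => R k ω) k
    have h3 : ((X k).pushed : ℝ) ≤ N := by exact_mod_cast h1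
    have h4 : ((X 0).pushed : ℝ) ≤ N := by exact_mod_cast hs
    rw [abs_le]
    constructor <;> linarith [Nat.cast_nonneg (α := ℝ) (X k).pushed,
      Nat.cast_nonneg (α := ℝ) (X 0).pushed]
  -- The count stays in `[0, N]`, so its average increment, pushes minus hits, tends to zero. Hits
  -- have rate `pc * pushed / N`, and `pushed = level - pushes`; multiplication by `N` gives the
  -- claim.
  have h := ((tendsto_bounded_div hb).add hω).const_mul (N : ℝ)
  simp only [add_zero, mul_zero] at h
  refine h.congr fun K => ?_
  rw [← Finset.sum_range_sub (fun k => ((X k).pushed : ℝ)), ← add_div, ← Finset.sum_add_distrib,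
    mul_div_assoc', Finset.mul_sum]
  congr 1
  refine Finset.sum_congr rfl fun k _ => ?_
  have h1 : ((X (k + 1)).pushed : ℝ) = (X k).pushed - hit (X k).pushed (R k ω) + pushes (μ (X k)) :=
    nextPushed_cast _ _ _
  have hN0 : (N : ℝ) ≠ 0 := by positivity
  rw [h1, level]
  push_cast
  field_simp
  ring

/-- If the level eventually is `C`, then pushes and blocked requests have the rates of the
threshold `C`. -/
lemma tendsto_of_eventually_level (hX : IsSlotProcess P N pu pc v Abar A J R) (hN : 1 ≤ N)
    (hpc : 0 < pc) (hμ : Measurable μ) (hlev : ∀ s : State, s.pushed ≤ N → level μ s ≤ N)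
    (hs : s₀.pushed ≤ N) {C : ℕ}
    (hC : ∀ᵐ ω ∂P, ∀ᶠ k in atTop, level μ (path B Ep μ s₀ A R ω k) = C) :
    ∀ᵐ ω ∂P, Tendsto (averagePower Ep μ (path B Ep μ s₀ A R ω)) atTop
        (𝓝 (pc * C / (N + pc) * Ep)) ∧
      Tendsto (blockedRatio μ (path B Ep μ s₀ A R ω) (fun k => J k ω)) atTop
        (𝓝 (blockProb N pu v C)) := by
  filter_upwards [hC, tendsto_average_balance (B := B) (Ep := Ep) hX hN hμ hlev hs,
    tendsto_blockedRatio_sub (B := B) (Ep := Ep) hX hN hμ hlev hs] with ω h1 h2 h3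
  set X := path B Ep μ s₀ A R ω with hXdef
  have hav : ∀ g : ℕ → ℝ, Tendsto (fun K : ℕ => (∑ k ∈ Finset.range K, g (level μ (X k))) / K)
      atTop (𝓝 (g C)) := by
    intro g
    have h4 : Tendsto (fun k => g (level μ (X k))) atTop (𝓝 (g C)) :=
      tendsto_const_nhds.congr' (h1.mono fun k hk => by simp only [hk])
    refine h4.cesaro.congr fun K => ?_
    rw [inv_mul_eq_div]
  constructor
  · have h5 := (h2.add ((hav fun l => (l : ℝ)).const_mul pc)).const_mul (Ep / (N + pc))
    have hN0 : (N : ℝ) + pc ≠ 0 := by positivity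
    rw [show Ep / (N + pc) * (0 + pc * (C : ℝ)) = pc * C / (N + pc) * Ep by ring] at h5
    refine h5.congr fun K => ?_
    rw [averagePower_eq, Finset.sum_sub_distrib, ← Finset.mul_sum, ← Finset.mul_sum]
    field_simp
    ring
  · have h5 := h3.add (hav (blockProb N pu v))
    simpa using h5

end Averages

/-! ### Pathwise behaviour of threshold policies. -/

section Policies

variable {Ep : ℝ} {C N : ℕ}

lemma measurable_thresholdPolicy (Ep : ℝ) (C : ℕ) : Measurable (thresholdPolicy Ep C) :=
  Measurable.ite ((measurableSet_lt measurable_pushed measurable_const).inter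
    (measurableSet_le measurable_const measurable_energy)) measurable_const measurable_const

lemma measurable_unconstrainedPolicy (C : ℕ) : Measurable (unconstrainedPolicy C) :=
  Measurable.ite (measurableSet_lt measurable_pushed measurable_const) measurable_const
    measurable_const

lemma pushes_thresholdPolicy (Ep : ℝ) (C : ℕ) (s : State) :
    pushes (thresholdPolicy Ep C s) = if s.pushed < C ∧ Ep ≤ s.energy then 1 else 0 := by
  unfold thresholdPolicy
  split_ifs <;> rfl

lemma pushes_unconstrainedPolicy (C : ℕ) (s : State) :
    pushes (unconstrainedPolicy C s) = if s.pushed < C then 1 else 0 := by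
  unfold unconstrainedPolicy
  split_ifs <;> rfl

lemma thresholdPolicy_level_le (s : State) : level (thresholdPolicy Ep C) s ≤ max s.pushed C := by
  rw [level, pushes_thresholdPolicy]
  split_ifs <;> omega

lemma unconstrainedPolicy_level_le (s : State) :
    level (unconstrainedPolicy C) s ≤ max s.pushed C := by
  rw [level, pushes_unconstrainedPolicy]
  split_ifs <;> omega

lemma level_le_of_le_max {μ : State → Action} (hμ : ∀ s, level μ s ≤ max s.pushed C) (hCN : C ≤ N)
    (s : State) (hs : s.pushed ≤ N) : level μ s ≤ N :=
  (hμ s).trans (max_le hs hCN)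

lemma exists_add_le_of_frequently_lt {u : ℕ → ℤ} (hu : ∀ k, u k ≤ u (k + 1))
    (hf : ∃ᶠ k in atTop, u k < u (k + 1)) (n : ℕ) : ∃ k, u 0 + n ≤ u k := by
  induction n with
  | zero => exact ⟨0, by simp⟩
  | succ n ih =>
    obtain ⟨k, hk⟩ := ih
    obtain ⟨l, hl, hl'⟩ := frequently_atTop.1 hf k
    have := monotone_nat_of_le_succ hu hl
    exact ⟨l + 1, by push_cast; omega⟩

variable {B : WithTop ℝ} {s₀ : State} {a : ℕ → ℝ} {r : ℕ → ℕ}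

lemma nextPushed_natCast_int (c : ℕ) (u : Action) (r : ℕ) :
    (nextPushed c u r : ℤ) = c - (if 1 ≤ r ∧ r ≤ c then 1 else 0) + pushes u := by
  cases u <;> simp only [nextPushed, pushes] <;> split_ifs <;> push_cast <;> omega

/-- A policy that never pushes from `C` or more contents eventually has at most `C` contents. -/
lemma eventually_pushed_le {μ : State → Action} (hμ : ∀ s, level μ s ≤ max s.pushed C)
    (hr : ∃ᶠ k in atTop, r k = 1) :
    ∀ᶠ k in atTop, (trajectory B Ep μ s₀ a r k).pushed ≤ C := by
  set X := trajectory B Ep μ s₀ a r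
  have hstep : ∀ k, (X (k + 1)).pushed = nextPushed (X k).pushed (μ (X k)) (r k) := fun _ => rfl
  have hstay : ∀ k, (X k).pushed ≤ C → (X (k + 1)).pushed ≤ C := fun k hk =>
    (trajectory_pushed_succ_le B Ep μ s₀ a r k).trans ((hμ _).trans (max_le hk le_rfl))
  by_cases h : ∃ k, (X k).pushed ≤ C
  · obtain ⟨k, hk⟩ := h
    exact eventually_atTop.2 ⟨k, fun l hl => Nat.le_induction hk (fun l _ => hstay l) l hl⟩
  · push Not at h
    exfalso
    -- If the count stayed above `C`, nothing would ever be pushed and rank 1 would always be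
    -- stored, so infinitely many replacements of rank 1 would lower the count without end.
    have hz : ∀ k, pushes (μ (X k)) = 0 := fun k => by
      have h1 := hμ (X k)
      have h2 := h k
      rw [level, max_eq_left h2.le] at h1
      omega
    have hi : ∀ k, ((X (k + 1)).pushed : ℤ) =
        (X k).pushed - (if 1 ≤ r k ∧ r k ≤ (X k).pushed then 1 else 0) := fun k => by
      rw [hstep, nextPushed_natCast_int, hz]; simp
    obtain ⟨k, hk⟩ := exists_add_le_of_frequently_lt (u := fun k => -((X k).pushed : ℤ))
      (fun k => by have := hi k; split_ifs at this <;> omega)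
      (hr.mono fun k hk => by
        have := hi k
        rw [if_pos ⟨hk.ge, by have := h k; omega⟩] at this
        omega) ((X 0).pushed + 1)
    push_cast at hk
    omega

/-- Below `C - 1` every slot pushes, and a replacement of rank `N` misses the stored contents, so
the count climbs. It never falls below `C - 1` again: at `C - 1` a loss is made up by the push of
the same slot, and from `C` on a slot loses at most one. -/
lemma eventually_le_pushed_succ (hCN : C ≤ N) (hr : ∃ᶠ k in atTop, r k = N) :
    ∀ᶠ k in atTop, C ≤ (trajectory B Ep (unconstrainedPolicy C) s₀ a r k).pushed + 1 := by
  set X := trajectory B Ep (unconstrainedPolicy C) s₀ a r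
  have hi : ∀ k, ((X (k + 1)).pushed : ℤ) = (X k).pushed -
      (if 1 ≤ r k ∧ r k ≤ (X k).pushed then 1 else 0) + (if (X k).pushed < C then 1 else 0) := by
    intro k
    have : (X (k + 1)).pushed =
      nextPushed (X k).pushed (unconstrainedPolicy C (X k)) (r k) := rfl
    rw [this, nextPushed_natCast_int, pushes_unconstrainedPolicy]
    push_cast; rfl
  have hstay : ∀ k, C ≤ (X k).pushed + 1 → C ≤ (X (k + 1)).pushed + 1 := fun k hk => by
    have := hi k
    split_ifs at this <;> omega
  by_cases h : ∃ k, C ≤ (X k).pushed + 1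
  · obtain ⟨k, hk⟩ := h
    exact eventually_atTop.2 ⟨k, fun l hl => Nat.le_induction hk (fun l _ => hstay l) l hl⟩
  · push Not at h
    exfalso
    obtain ⟨k, hk⟩ := exists_add_le_of_frequently_lt (u := fun k => ((X k).pushed : ℤ))
      (fun k => by have := hi k; have := h k; split_ifs at * <;> omega)
      (hr.mono fun k hk => by
        have := hi k
        have h1 := h k
        rw [if_neg (by omega), if_pos (by omega)] at this
        omega) C
    have := h k
    omega

/-- The count eventually lies between `C - 1` and `C`; the policy pushes at `C - 1` and sleeps at
`C`, so the level agrees in both cases. -/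
lemma unconstrainedPolicy_eventually_level (hCN : C ≤ N) (hr1 : ∃ᶠ k in atTop, r k = 1)
    (hrN : ∃ᶠ k in atTop, r k = N) :
    ∀ᶠ k in atTop, level (unconstrainedPolicy C)
      (trajectory B Ep (unconstrainedPolicy C) s₀ a r k) = C := by
  filter_upwards [eventually_pushed_le (B := B) (Ep := Ep) (s₀ := s₀) (a := a)
    (unconstrainedPolicy_level_le (C := C)) hr1,
    eventually_le_pushed_succ (B := B) (Ep := Ep) (s₀ := s₀) (a := a) hCN hrN] with k h1 h2
  rw [level, pushes_unconstrainedPolicy]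
  split_ifs <;> omega

end Policies

/-! ### Powered pushes and optimality of the threshold. -/

section Unconstrained

variable {Ω : Type*} [MeasurableSpace Ω] {P : Measure Ω} [IsProbabilityMeasure P] {N : ℕ}
  {pu pc v Abar : ℝ} {A : ℕ → Ω → ℝ} {J R : ℕ → Ω → ℕ} {B : WithTop ℝ} {Ep : ℝ}

/-- Power and blocking probability when every push can be powered. -/
lemma tendsto_unconstrained (hX : IsSlotProcess P N pu pc v Abar A J R) (hN : 1 ≤ N)
    (hpc : 0 < pc) {C : ℕ} (hCN : C ≤ N) (s₀ : State) (hs : s₀.pushed ≤ N) :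
    ∀ᵐ ω ∂P, Tendsto (averagePower Ep (unconstrainedPolicy C)
        (path B Ep (unconstrainedPolicy C) s₀ A R ω)) atTop (𝓝 (pc * C / (N + pc) * Ep)) ∧
      Tendsto (blockedRatio (unconstrainedPolicy C)
        (path B Ep (unconstrainedPolicy C) s₀ A R ω) (fun k => J k ω)) atTop
        (𝓝 (blockProb N pu v C)) := by
  refine tendsto_of_eventually_level hX hN hpc (measurable_unconstrainedPolicy C)
    (level_le_of_le_max unconstrainedPolicy_level_le hCN) hs ?_
  filter_upwards [hX.frequently_replaced hN hpc (i := 1) (by simp [hN]),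
    hX.frequently_replaced hN hpc (i := N) (by simp [hN])] with ω h1 h2
  exact unconstrainedPolicy_eventually_level hCN h1 h2

lemma potbThreshold_le (N : ℕ) (pc Abar Ep : ℝ) : potbThreshold N pc Abar Ep ≤ N := min_le_left _ _

lemma power_potbThreshold_le (hpc : 0 < pc) (hEp : 0 < Ep) (hA : 0 ≤ Abar) :
    pc * potbThreshold N pc Abar Ep / (N + pc) * Ep ≤ Abar := by
  have h1 : (potbThreshold N pc Abar Ep : ℝ) ≤ ((N : ℝ) + pc) * Abar / (pc * Ep) :=
    (Nat.cast_le.2 (min_le_right _ _)).trans (Nat.floor_le (by positivity))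
  rw [le_div_iff₀ (by positivity)] at h1
  rw [div_mul_eq_mul_div, div_le_iff₀ (by positivity)]
  linarith

/-- The floor is the power constraint solved for `C`; together with `power_potbThreshold_le`, the
POTB threshold is the largest feasible one. -/
lemma le_potbThreshold (hpc : 0 < pc) (hEp : 0 < Ep) {C : ℕ} (hCN : C ≤ N)
    (h : pc * C / (N + pc) * Ep ≤ Abar) : C ≤ potbThreshold N pc Abar Ep := by
  refine le_min hCN (Nat.le_floor ?_)
  rw [div_mul_eq_mul_div, div_le_iff₀ (by positivity)] at h
  rw [le_div_iff₀ (by positivity)]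
  linarith

/-- Optimality of the threshold among the thresholds that meet the average power constraint. -/
lemma isLeast_blockProb (hX : IsSlotProcess P N pu pc v Abar A J R) (hN : 1 ≤ N)
    (hpu : 0 ≤ pu) (hpc : 0 < pc) (hEp : 0 < Ep) :
    IsLeast {b : ℝ | IsAveragePowerBlocking P N Ep Abar A J R b}
      (blockProb N pu v (potbThreshold N pc Abar Ep)) := by
  have hCN := potbThreshold_le N pc Abar Ep
  constructor
  · exact ⟨potbThreshold N pc Abar Ep, hCN, _,
      power_potbThreshold_le hpc hEp hX.arrival_mean_nonneg, fun s₀ hs =>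
      tendsto_unconstrained hX hN hpc hCN s₀ hs⟩
  · rintro b ⟨C, hC, w, hw, h⟩
    -- A single sample point at which both pairs of limits hold identifies `w` and `b`.
    obtain ⟨ω, h1, h2⟩ := ((h ⟨0, 0⟩ (Nat.zero_le _)).and
      (tendsto_unconstrained hX hN hpc hC ⟨0, 0⟩ (Nat.zero_le _))).exists
    have e1 := tendsto_nhds_unique h1.1 h2.1
    rw [tendsto_nhds_unique h1.2 h2.2]
    exact blockProb_anti hpu (le_potbThreshold hpc hEp hC (e1 ▸ hw))

end Unconstrained

/-! ### Shortfall of the battery and pushes within one slot. -/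

section Slot

variable {B : WithTop ℝ} {b Ep M : ℝ}

lemma hit_eq_zero_or_one (c r : ℕ) : hit c r = 0 ∨ hit c r = 1 := by
  unfold hit
  split_ifs <;> simp

/-- Energy missing to the level `b`. -/
noncomputable def shortfall (b x : ℝ) : ℝ := max (b - x) 0

lemma shortfall_nonneg (b x : ℝ) : 0 ≤ shortfall b x := le_max_right _ _

lemma shortfall_le {x : ℝ} (hb : 0 ≤ b) (hx : 0 ≤ x) : shortfall b x ≤ b :=
  max_le (by linarith) hb

lemma sub_le_shortfall (b x : ℝ) : b - x ≤ shortfall b x := le_max_left _ _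

lemma abs_shortfall_sub_le (b x y : ℝ) : |shortfall b x - shortfall b y| ≤ |x - y| := by
  refine (abs_max_sub_max_le_abs _ _ _).trans (le_of_eq ?_)
  rw [abs_sub_comm]; congr 1; ring

lemma measurable_shortfall (b : ℝ) : Measurable (shortfall b) :=
  (measurable_const.sub measurable_id).max measurable_const

/-- Clipping at a capacity `B ≥ b` changes only energies above `b`, where the shortfall is zero
anyway. The estimates relative to `b` therefore serve finite and infinite capacity alike. -/
lemma shortfall_store (hb : (b : WithTop ℝ) ≤ B) (x : ℝ) :
    shortfall b (store B x) = shortfall b x := by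
  cases B with
  | top => rfl
  | coe B =>
    have hb' : b ≤ B := WithTop.coe_le_coe.1 hb
    simp only [store, shortfall]
    rcases le_total B x with h | h
    · rw [min_eq_left h, max_eq_right (by linarith), max_eq_right (by linarith)]
    · rw [min_eq_right h]

lemma shortfall_sq_le (x y : ℝ) :
    shortfall b y ^ 2 ≤ (shortfall b x - (y - x)) ^ 2 := by
  unfold shortfall
  rcases le_total (b - y) 0 with h | h
  · rw [max_eq_right h, zero_pow two_ne_zero]; positivity
  · rw [max_eq_left h]
    have := le_max_left (b - x) 0
    nlinarith

/-- Drift of the quadratic potential. Replacing the arrival by `min a M` can only increase the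
shortfall, and it bounds the second-order term although the arrivals may have infinite variance. -/
lemma shortfall_store_sq_le (hb : (b : WithTop ℝ) ≤ B) (hEp : 0 ≤ Ep) (hM : 0 ≤ M) (E : ℝ) {a π : ℝ}
    (ha : 0 ≤ a) (hπ0 : 0 ≤ π) (hπ1 : π ≤ 1) :
    shortfall b (store B (E - Ep * π + a)) ^ 2 ≤
      shortfall b E ^ 2 - 2 * shortfall b E * (min a M - Ep * π) + (M + Ep) ^ 2 := by
  rw [shortfall_store hb]
  have h1 : shortfall b (E - Ep * π + a) ≤ shortfall b (E - Ep * π + min a M) :=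
    max_le_max (by linarith [min_le_left a M]) le_rfl
  have h2 := pow_le_pow_left₀ (shortfall_nonneg _ _) h1 2
  have h3 := shortfall_sq_le (b := b) E (E - Ep * π + min a M)
  have h4 : 0 ≤ min a M := le_min ha hM
  have h5 := min_le_right a M
  have h6 : 0 ≤ Ep * π := by positivity
  have h7 : Ep * π ≤ Ep := mul_le_of_le_one_right hEp hπ1
  have h8 : (min a M - Ep * π) ^ 2 ≤ (M + Ep) ^ 2 := by
    rw [sq_le_sq, abs_of_nonneg (by linarith : 0 ≤ M + Ep), abs_le]
    constructor <;> linarith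
  nlinarith

variable {N C : ℕ} {pc : ℝ}

/-- While the battery is not close to empty, pushes compensate for the replacements, up to the
increments of the indicator that fewer than `C` contents are pushed. -/
lemma push_deficit_le (hN : 1 ≤ N) (hpc : pc ∈ Set.Ioc (0 : ℝ) 1) (hCN : C ≤ N) (hb : 0 < b)
    (hEp : 0 < Ep) {s : State} (hs : s.pushed ≤ N) (r : ℕ) {q : ℝ} (hq0 : 0 ≤ q)
    (hq1 : q ≤ 1) (hqE : q ≤ s.energy / b) :
    q * (pc * C / (N + pc) - pushes (thresholdPolicy Ep C s)) ≤
      N / (N + pc) * q * ((if nextPushed s.pushed (thresholdPolicy Ep C s) r < C then 1 else 0) -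
        (if s.pushed < C then 1 else 0)) -
      N / (N + pc) * (q * (if C ≤ s.pushed + 1 then 1 else 0) *
        (hit s.pushed r - pc * s.pushed / N)) + 3 * Ep / b +
      2 * (if C < s.pushed then 1 else 0) := by
  have hpc0 := hpc.1
  have hN0 : (0 : ℝ) < N := by exact_mod_cast hN
  have hCN' : (C : ℝ) ≤ N := by exact_mod_cast hCN
  have hsN' : (s.pushed : ℝ) ≤ N := by exact_mod_cast hs
  have hs0' : (0 : ℝ) ≤ s.pushed := Nat.cast_nonneg _
  have hC0 : (0 : ℝ) ≤ C := Nat.cast_nonneg _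
  set κ : ℝ := N / (N + pc) with hκ
  set ρ : ℝ := pc * C / (N + pc) with hρ
  have hκ0 : 0 ≤ κ := by positivity
  have hκ1 : κ ≤ 1 := by rw [hκ, div_le_one (by positivity)]; linarith
  have hρ0 : 0 ≤ ρ := by positivity
  have hρ1 : ρ ≤ 1 := by
    rw [hρ, div_le_one (by positivity)]
    nlinarith [hpc.2]
  have hρκ : ρ = κ * (pc * C / N) := by rw [hρ, hκ]; field_simp
  have hH0 := hit_nonneg s.pushed r
  have hH1 := hit_le_one s.pushed r
  have hH01 := hit_eq_zero_or_one s.pushed r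
  have hnext := nextPushed_cast s.pushed (thresholdPolicy Ep C s) r
  rw [pushes_thresholdPolicy] at hnext ⊢
  set H := hit s.pushed r with hH
  set c' := nextPushed s.pushed (thresholdPolicy Ep C s) r with hc'
  have hd : 0 ≤ pc * s.pushed / N := by positivity
  have hEb : 0 ≤ Ep / b := by positivity
  have hZ0 : (0 : ℝ) ≤ if c' < C then 1 else 0 := by split_ifs <;> norm_num
  have hκq0 : 0 ≤ κ * q := by positivity
  have hκqq : κ * q ≤ q := mul_le_of_le_one_left hq0 hκ1
  have hκqH : κ * q * H ≤ κ * q := mul_le_of_le_one_right hκq0 hH1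
  have hκqd : 0 ≤ κ * q * (pc * s.pushed / N) := by positivity
  have hκqZ : 0 ≤ κ * q * (if c' < C then 1 else 0) := by positivity
  have hqρ : q * ρ ≤ q := mul_le_of_le_one_right hq0 hρ1
  -- Counts above `C` are transient, so the crude last term may absorb them.
  rcases lt_or_ge C s.pushed with h1 | h1
  · have h2 : ¬ s.pushed < C := by omega
    have h3 : C ≤ s.pushed + 1 := by omega
    simp only [h1, h2, h3, false_and, if_true, if_false]
    push_cast
    have : 3 * Ep / b = 3 * (Ep / b) := by ring
    linarith
  · have h1' : ¬ C < s.pushed := by omega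
    -- Without the energy for a push, `q ≤ Ep / b`; three terms of size at most `q` make up `3 * Ep
    -- / b`.
    rcases lt_or_ge s.energy Ep with h2 | h2
    · have h2' : ¬ Ep ≤ s.energy := by linarith
      have hqE' : q ≤ Ep / b := hqE.trans (by gcongr)
      have hy : κ * (q * (if C ≤ s.pushed + 1 then 1 else 0) * (H - pc * s.pushed / N)) ≤ q := by
        split_ifs
        · linarith
        · simpa using hq0
      have hz : -q ≤ κ * q * ((if c' < C then 1 else 0) - (if s.pushed < C then 1 else 0)) := by
        have : (if s.pushed < C then 1 else 0 : ℝ) ≤ 1 := by split_ifs <;> norm_num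
        have := mul_le_of_le_one_right hκq0 this
        linarith
      simp only [h1', h2', and_false, if_false]
      push_cast
      have : 3 * Ep / b = 3 * (Ep / b) := by ring
      linarith
    · have h3 : 0 ≤ 3 * Ep / b := by positivity
      rcases h1.lt_or_eq with h4 | h4
      · rw [if_pos ⟨h4, h2⟩] at hnext ⊢
        rw [if_pos h4, if_neg h1']
        -- Below `C - 1` the push outweighs the target rate, which is at most one, and the indicator
        -- keeps its value. At `C - 1`, and at `C` further down, the next indicator equals the hit,
        -- and the main terms balance exactly.
        rcases Nat.lt_or_ge (s.pushed + 1) C with h5 | h5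
        · have h6 : c' < C := by
            have : (c' : ℝ) ≤ ((s.pushed + 1 : ℕ) : ℝ) := by push_cast at hnext ⊢; linarith
            have : c' ≤ s.pushed + 1 := by exact_mod_cast this
            omega
          rw [if_pos h6, if_neg (by omega)]
          push_cast
          linarith
        · have h6 : s.pushed + 1 = C := by omega
          have h7 : (s.pushed : ℝ) = C - 1 := by
            rw [← h6]; push_cast; ring
          have h8 : (if c' < C then (1 : ℝ) else 0) = H := by
            rcases hH01 with h | h
            · rw [if_neg, h]
              have : (c' : ℝ) = C := by rw [hnext, h, h7]; push_cast; ring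
              have : c' = C := by exact_mod_cast this
              omega
            · rw [if_pos, h]
              have : (c' : ℝ) < C := by rw [hnext, h, h7]; push_cast; linarith
              exact_mod_cast this
          rw [h8, if_pos h5, h7]
          push_cast
          have : q * (ρ - 1) = κ * q * (H - 1) - κ * (q * 1 * (H - pc * (C - 1) / N)) := by
            rw [hρ, hκ]; field_simp; ring
          linarith
      · have h5 : ¬ s.pushed < C := by omega
        have h7 : (s.pushed : ℝ) = C := by exact_mod_cast h4
        rw [if_neg (fun h => h5 h.1)] at hnext ⊢
        have h8 : (if c' < C then (1 : ℝ) else 0) = H := by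
          rcases hH01 with h | h
          · rw [if_neg, h]
            have : (c' : ℝ) = C := by rw [hnext, h, h7]; push_cast; ring
            have : c' = C := by exact_mod_cast this
            omega
          · rw [if_pos, h]
            have : (c' : ℝ) < C := by rw [hnext, h, h7]; push_cast; linarith
            exact_mod_cast this
        rw [h8, if_neg h5, if_neg h1', if_pos (by omega), h7, hρκ]
        have : q * (κ * (pc * C / N)) = κ * q * H - κ * (q * 1 * (H - pc * C / N)) := by ring
        push_cast
        linarith

end Slot

/-! ### Potential function for the deficit of pushes. -/

section EnergyAccounting

variable {B : WithTop ℝ} {b Ep M : ℝ} {N C : ℕ} {pc : ℝ}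

lemma store_nonneg (hb : 0 ≤ b) (hbB : (b : WithTop ℝ) ≤ B) {x : ℝ} (hx : 0 ≤ x) :
    0 ≤ store B x := by
  cases B with
  | top => exact hx
  | coe B => exact le_min (hb.trans (WithTop.coe_le_coe.1 hbB)) hx

lemma energyUse_thresholdPolicy_le {s : State} (hs : 0 ≤ s.energy) :
    energyUse Ep (thresholdPolicy Ep C s) ≤ s.energy := by
  rw [energyUse_eq, pushes_thresholdPolicy]
  split_ifs with h
  · simpa using h.2
  · simpa using hs

lemma trajectory_energy_nonneg (hb : 0 ≤ b) (hbB : (b : WithTop ℝ) ≤ B)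
    {s₀ : State} (hs : 0 ≤ s₀.energy) {a : ℕ → ℝ} (ha : ∀ k, 0 ≤ a k) (r : ℕ → ℕ) (k : ℕ) :
    0 ≤ (trajectory B Ep (thresholdPolicy Ep C) s₀ a r k).energy := by
  induction k with
  | zero => exact hs
  | succ k ih =>
    refine store_nonneg hb hbB ?_
    linarith [ha k, energyUse_thresholdPolicy_le (C := C) (Ep := Ep) ih]

/-- Relative shortfall, truncated at `1`. -/
noncomputable def emptiness (b : ℝ) (s : State) : ℝ := min (shortfall b s.energy / b) 1

lemma emptiness_nonneg (hb : 0 < b) (s : State) : 0 ≤ emptiness b s :=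
  le_min (div_nonneg (shortfall_nonneg _ _) hb.le) zero_le_one

lemma emptiness_le_one (b : ℝ) (s : State) : emptiness b s ≤ 1 := min_le_right _ _

lemma emptiness_eq (hb : 0 < b) {s : State} (hs : 0 ≤ s.energy) :
    emptiness b s = shortfall b s.energy / b :=
  min_eq_left ((div_le_one hb).2 (shortfall_le hb.le hs))

lemma measurable_emptiness (b : ℝ) : Measurable (emptiness b) :=
  (((measurable_shortfall b).comp measurable_energy).div_const b).min measurable_const

/-- Bounded part of the energy accounting. -/
noncomputable def account (N C : ℕ) (pc b Ep : ℝ) (s : State) : ℝ :=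
  Ep * (N / (N + pc)) * ((1 - emptiness b s) * (if s.pushed < C then 1 else 0)) -
    shortfall b s.energy ^ 2 / (2 * b)

lemma abs_account_le (hpc : 0 < pc) (hb : 0 < b) (hEp : 0 < Ep) {s : State} (hs : 0 ≤ s.energy) :
    |account N C pc b Ep s| ≤ Ep + b / 2 := by
  have h1 : shortfall b s.energy ^ 2 / (2 * b) ≤ b / 2 := by
    rw [div_le_iff₀ (by positivity)]
    have := pow_le_pow_left₀ (shortfall_nonneg b s.energy) (shortfall_le hb.le hs) 2
    nlinarith
  have h2 : 0 ≤ shortfall b s.energy ^ 2 / (2 * b) := by positivity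
  have h3 := emptiness_nonneg hb s
  have h4 := emptiness_le_one b s
  have h5 : (N : ℝ) / (N + pc) ≤ 1 := by rw [div_le_one (by positivity)]; linarith
  have h5' : 0 ≤ (N : ℝ) / (N + pc) := by positivity
  have h6 : 0 ≤ (1 - emptiness b s) * (if s.pushed < C then 1 else 0) := by
    split_ifs <;> linarith
  have h7 : (1 - emptiness b s) * (if s.pushed < C then 1 else 0) ≤ 1 := by
    split_ifs <;> linarith
  have h8 : Ep * (N / (N + pc)) ≤ Ep := mul_le_of_le_one_right hEp.le h5
  have h9 : 0 ≤ Ep * (N / (N + pc)) := by positivity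
  have h10 : Ep * (N / (N + pc)) * ((1 - emptiness b s) * (if s.pushed < C then 1 else 0)) ≤ Ep :=
    (mul_le_of_le_one_right h9 h7).trans h8
  have h11 : 0 ≤ Ep * (N / (N + pc)) * ((1 - emptiness b s) * (if s.pushed < C then 1 else 0)) :=
    mul_nonneg h9 h6
  unfold account
  rw [abs_le]
  constructor <;> linarith

/-- Split the deficit with weights `w = emptiness` and `1 - w`. On the part `w`, the drift of
`shortfall ^ 2 / (2 * b)` replaces the spent energy by the truncated arrival. On the part `1 - w`,
`push_deficit_le` applies because `1 - w ≤ energy / b`. The increment of `account` collects what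
telescopes. -/
lemma deficit_le (hN : 1 ≤ N) (hpc : pc ∈ Set.Ioc (0 : ℝ) 1) (hCN : C ≤ N) (hb : 0 < b)
    (hbB : (b : WithTop ℝ) ≤ B) (hEp : 0 < Ep) (hM : 0 ≤ M) {s : State} (hs0 : 0 ≤ s.energy)
    (hs : s.pushed ≤ N) {a : ℝ} (ha : 0 ≤ a) (r : ℕ) :
    Ep * (pc * C / (N + pc) - pushes (thresholdPolicy Ep C s)) ≤
      account N C pc b Ep (step B Ep s (thresholdPolicy Ep C s) a r) - account N C pc b Ep s +
      emptiness b s * (Ep * (pc * C / (N + pc)) - min a M) -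
      Ep * (N / (N + pc)) * ((1 - emptiness b s) * (if C ≤ s.pushed + 1 then 1 else 0) *
        (hit s.pushed r - pc * s.pushed / N)) +
      Ep / b * a + 2 * Ep * (if C < s.pushed then 1 else 0) +
      ((M + Ep) ^ 2 / (2 * b) + 4 * Ep ^ 2 / b) := by
  set u := thresholdPolicy Ep C s with hu
  set s' := step B Ep s u a r with hs'
  have huse := energyUse_thresholdPolicy_le (C := C) (Ep := Ep) hs0
  have hπ1 : (pushes u : ℝ) ≤ 1 := by exact_mod_cast pushes_le_one u
  have hπ0 : (0 : ℝ) ≤ pushes u := Nat.cast_nonneg _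
  have hE' : s'.energy = store B (s.energy - Ep * pushes u + a) := by
    rw [← energyUse_eq]; rfl
  have hc' : s'.pushed = nextPushed s.pushed u r := rfl
  rw [← hu, energyUse_eq] at huse
  have hs'0 : 0 ≤ s'.energy := by
    rw [hE']; exact store_nonneg hb.le hbB (by linarith)
  have h1 := shortfall_store_sq_le hbB hEp.le hM s.energy ha hπ0 hπ1
  rw [← hE'] at h1
  have hw0 := emptiness_nonneg hb s
  have hw1 := emptiness_le_one b s
  have hweq := emptiness_eq hb hs0
  have hw'eq := emptiness_eq hb hs'0
  have hqE : 1 - emptiness b s ≤ s.energy / b := by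
    rw [hweq, sub_le_iff_le_add, ← add_div, le_div_iff₀ hb]
    linarith [sub_le_shortfall b s.energy]
  have h2 := push_deficit_le hN hpc hCN hb hEp hs r (q := 1 - emptiness b s)
    (by linarith) (by linarith) hqE
  rw [← hu, ← hc'] at h2
  have h3 : |emptiness b s - emptiness b s'| ≤ (a + Ep) / b := by
    rw [hweq, hw'eq, ← sub_div, abs_div, abs_of_pos hb, hE', shortfall_store hbB]
    gcongr
    refine (abs_shortfall_sub_le _ _ _).trans ?_
    have : Ep * pushes u ≤ Ep := mul_le_of_le_one_right hEp.le hπ1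
    have : 0 ≤ Ep * pushes u := by positivity
    rw [abs_le]
    constructor <;> linarith
  have hN0 : (0 : ℝ) < N := by exact_mod_cast hN
  have hpc0 := hpc.1
  set κ : ℝ := N / (N + pc) with hκ
  set ρ : ℝ := pc * C / (N + pc) with hρ
  have hκ0 : 0 ≤ κ := by positivity
  have hκ1 : κ ≤ 1 := by rw [hκ, div_le_one (by positivity)]; linarith
  set w := emptiness b s with hw
  set w' := emptiness b s' with hw'
  set Z : ℝ := if s.pushed < C then 1 else 0 with hZ
  set Z' : ℝ := if s'.pushed < C then 1 else 0 with hZ'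
  have hZ'0 : 0 ≤ Z' := by rw [hZ']; split_ifs <;> norm_num
  have hZ'1 : Z' ≤ 1 := by rw [hZ']; split_ifs <;> norm_num
  -- Summation by parts: the new indicator receives the new weight, so that the product telescopes.
  -- The weight moves by at most `(a + Ep) / b` in a slot.
  have h4 : κ * (1 - w) * (Z' - Z) ≤ κ * ((1 - w') * Z') - κ * ((1 - w) * Z) + (a + Ep) / b := by
    have h5 : κ * Z' * (w' - w) ≤ (a + Ep) / b := by
      have h6 : w' - w ≤ (a + Ep) / b := by
        have := (abs_le.1 h3).1
        linarith
      have h7 : 0 ≤ (a + Ep) / b := by positivity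
      have h8 : κ * Z' ≤ 1 := mul_le_one₀ hκ1 hZ'0 hZ'1
      have h9 : 0 ≤ κ * Z' := mul_nonneg hκ0 hZ'0
      calc κ * Z' * (w' - w) ≤ κ * Z' * ((a + Ep) / b) := by gcongr
        _ ≤ (a + Ep) / b := mul_le_of_le_one_left h7 h8
    linarith
  have h5 : w * (min a M - Ep * pushes u) ≤
      (shortfall b s.energy ^ 2 - shortfall b s'.energy ^ 2 + (M + Ep) ^ 2) / (2 * b) := by
    rw [hweq, le_div_iff₀ (by positivity)]
    have : shortfall b s.energy / b * (min a M - Ep * pushes u) * (2 * b) =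
        2 * shortfall b s.energy * (min a M - Ep * pushes u) := by field_simp
    rw [this]
    linarith
  have h6 := mul_le_mul_of_nonneg_left (h2.trans (by linarith [h4] :
    _ ≤ κ * ((1 - w') * Z') - κ * ((1 - w) * Z) + (a + Ep) / b -
      κ * ((1 - w) * (if C ≤ s.pushed + 1 then 1 else 0) * (hit s.pushed r - pc * s.pushed / N)) +
      3 * Ep / b + 2 * (if C < s.pushed then 1 else 0))) hEp.le
  have e1 : Ep * ((a + Ep) / b) + Ep * (3 * Ep / b) = Ep / b * a + 4 * Ep ^ 2 / b := by ring
  have e2 : (shortfall b s.energy ^ 2 - shortfall b s'.energy ^ 2 + (M + Ep) ^ 2) / (2 * b) =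
    shortfall b s.energy ^ 2 / (2 * b) - shortfall b s'.energy ^ 2 / (2 * b) +
      (M + Ep) ^ 2 / (2 * b) := by ring
  unfold account
  linarith

end EnergyAccounting

/-! ### Long-run deficit and blocking for a large battery. -/

section Asymptotics

variable {Ω : Type*} [MeasurableSpace Ω] {P : Measure Ω} [IsProbabilityMeasure P] {N C : ℕ}
  {pu pc v Abar : ℝ} {A : ℕ → Ω → ℝ} {J R : ℕ → Ω → ℕ} {B : WithTop ℝ} {b Ep M : ℝ} {s₀ : State}

lemma tendsto_average_of_eventually_eq_zero {u : ℕ → ℝ} (hu : ∀ᶠ k in atTop, u k = 0) :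
    Tendsto (fun K : ℕ => (∑ k ∈ Finset.range K, u k) / K) atTop (𝓝 0) := by
  have h : Tendsto u atTop (𝓝 0) := tendsto_const_nhds.congr' (hu.mono fun k hk => hk.symm)
  refine h.cesaro.congr fun K => ?_
  rw [inv_mul_eq_div]

/-- Truncated arrivals weighted by a bounded function of the state. -/
lemma tendsto_average_min_arrival (hX : IsSlotProcess P N pu pc v Abar A J R) (hN : 1 ≤ N)
    {μ : State → Action} (hμ : Measurable μ) (s₀ : State) {w : State → ℝ} (hw : Measurable w)
    (hw1 : ∀ s, |w s| ≤ 1) (hM : 0 ≤ M) :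
    ∀ᵐ ω ∂P, Tendsto (fun K : ℕ => (∑ k ∈ Finset.range K, w (path B Ep μ s₀ A R ω k) *
      (∫ ω, min (A 0 ω) M ∂P - min (A k ω) M)) / K) atTop (𝓝 0) := by
  have hm : Measurable fun z : ℝ × ℕ × ℕ => min |z.1| M :=
    (measurable_fst.abs).min measurable_const
  have h := tendsto_average_path (B := B) (Ep := Ep) hX hN hμ s₀
    (φ := fun y => w y.1 * min |y.2.1| M)
    ((hw.comp measurable_fst).mul (hm.comp measurable_snd)) (c := M) (fun y => by
      have h1 : 0 ≤ min |y.2.1| M := le_min (abs_nonneg _) hM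
      rw [abs_mul, abs_of_nonneg h1]
      exact (mul_le_of_le_one_left h1 (hw1 _)).trans (min_le_right _ _))
  filter_upwards [h] with ω hω
  rw [← neg_zero]
  refine hω.neg.congr fun K => ?_
  rw [← neg_div, ← Finset.sum_neg_distrib]
  congr 1
  refine Finset.sum_congr rfl fun k _ => ?_
  have hI : ∫ z, min |z.1| M ∂slotLaw P A J R = ∫ ω, min (A 0 ω) M ∂P := by
    rw [slotLaw, integral_map (hX.measurable_slot 0).aemeasurable hm.aestronglyMeasurable]
    simp only [slot, abs_of_nonneg (hX.arrival_nonneg 0 _)]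
  rw [integral_const_mul, hI]
  simp only [slot, abs_of_nonneg (hX.arrival_nonneg k ω)]
  ring

/-- Upper bound for the long-run deficit of pushes. -/
noncomputable def deficitBound (Abar Ep b M t : ℝ) : ℝ :=
  t + Ep / b * Abar + ((M + Ep) ^ 2 / (2 * b) + 4 * Ep ^ 2 / b)

/-- Average `deficit_le` over the slots: the bounded potential and the transient excess disappear,
and the strong law removes the weighted hits and the fluctuation of the truncated arrivals. The mean
lost by truncation and the terms of order `1 / b` remain. -/
lemma exists_deficit_le (hX : IsSlotProcess P N pu pc v Abar A J R) (hN : 1 ≤ N)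
    (hpc : pc ∈ Set.Ioc (0 : ℝ) 1) (hCN : C ≤ N) (hfeas : pc * C / (N + pc) * Ep ≤ Abar)
    (hb : 0 < b) (hbB : (b : WithTop ℝ) ≤ B) (hEp : 0 < Ep) (hM : 0 ≤ M)
    (hs0 : 0 ≤ s₀.energy) (hs : s₀.pushed ≤ N) :
    ∀ᵐ ω ∂P, ∃ u : ℕ → ℝ,
      (∀ k, Ep * (pc * C / (N + pc) -
        pushes (thresholdPolicy Ep C (path B Ep (thresholdPolicy Ep C) s₀ A R ω k))) ≤ u k) ∧
      Tendsto (fun K : ℕ => (∑ k ∈ Finset.range K, u k) / K) atTop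
        (𝓝 (deficitBound Abar Ep b M (Abar - ∫ ω, min (A 0 ω) M ∂P))) := by
  have hμ := measurable_thresholdPolicy Ep C
  have hlev := level_le_of_le_max (N := N) (thresholdPolicy_level_le (Ep := Ep) (C := C)) hCN
  have hw : ∀ s, |emptiness b s| ≤ 1 := fun s => by
    rw [abs_of_nonneg (emptiness_nonneg hb s)]; exact emptiness_le_one b s
  have hset : MeasurableSet {s : State | C ≤ s.pushed + 1} :=
    measurableSet_le measurable_const (measurable_pushed.add_const 1)
  have hi : Integrable (fun ω => min (A 0 ω) M) P :=
    hX.arrival_integrable.inf (integrable_const M)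
  have ht : ∫ ω, min (A 0 ω) M ∂P ≤ Abar := by
    rw [← hX.arrival_mean]
    exact integral_mono hi hX.arrival_integrable fun ω => min_le_left _ _
  filter_upwards [hX.frequently_replaced hN hpc.1 (i := 1) (by simp [hN]),
    tendsto_average_min_arrival (B := B) (Ep := Ep) hX hN hμ s₀ (measurable_emptiness b) hw hM,
    tendsto_average_hit (B := B) (Ep := Ep) hX hN hμ hlev hs
      (w := fun s => (1 - emptiness b s) * (if C ≤ s.pushed + 1 then 1 else 0))
      ((measurable_const.sub (measurable_emptiness b)).mul
        (Measurable.ite hset measurable_const measurable_const)) (c := 1) (fun s => by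
          have := emptiness_nonneg hb s
          have := emptiness_le_one b s
          rw [abs_le]
          constructor <;> split_ifs <;> linarith),
    hX.tendsto_average_arrival measurable_id hX.arrival_integrable] with ω h1 h2 h3 h4
  set X := path B Ep (thresholdPolicy Ep C) s₀ A R ω with hXdef
  set t := Abar - ∫ ω, min (A 0 ω) M ∂P with htdef
  have hE : ∀ k, 0 ≤ (X k).energy := fun k =>
    trajectory_energy_nonneg hb.le hbB hs0 (fun k => hX.arrival_nonneg k ω) _ k
  have hc : ∀ k, (X k).pushed ≤ N := fun k => trajectory_pushed_le hlev hs _ _ k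
  refine ⟨fun k => (account N C pc b Ep (X (k + 1)) - account N C pc b Ep (X k)) +
      emptiness b (X k) * (∫ ω, min (A 0 ω) M ∂P - min (A k ω) M) -
      Ep * (N / (N + pc)) * ((1 - emptiness b (X k)) *
        (if C ≤ (X k).pushed + 1 then 1 else 0) *
        (hit (X k).pushed (R k ω) - pc * (X k).pushed / N)) +
      Ep / b * A k ω + 2 * Ep * (if C < (X k).pushed then 1 else 0) +
      (t + ((M + Ep) ^ 2 / (2 * b) + 4 * Ep ^ 2 / b)), fun k => ?_, ?_⟩
  · refine (deficit_le hN hpc hCN hb hbB hEp hM (hE k) (hc k) (hX.arrival_nonneg k ω)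
      (R k ω)).trans ?_
    have e : step B Ep (X k) (thresholdPolicy Ep C (X k)) (A k ω) (R k ω) = X (k + 1) := rfl
    rw [e]
    -- Here feasibility enters: the target power is at most `Abar`, and the truncation loss `t`
    -- carries a weight of at most one.
    have h5 : emptiness b (X k) * (Ep * (pc * C / (N + pc)) - min (A k ω) M) ≤
        emptiness b (X k) * (∫ ω, min (A 0 ω) M ∂P - min (A k ω) M) + t := by
      have h6 := emptiness_nonneg hb (X k)
      have h7 := emptiness_le_one b (X k)
      have h8 : emptiness b (X k) * t ≤ t := mul_le_of_le_one_left (by linarith) h7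
      have h9 : emptiness b (X k) * (Ep * (pc * C / (N + pc))) ≤ emptiness b (X k) * Abar := by
        gcongr; linarith
      have h10 : emptiness b (X k) * t =
        emptiness b (X k) * Abar - emptiness b (X k) * ∫ ω, min (A 0 ω) M ∂P := by
        rw [htdef]; ring
      linarith
    linarith
  · have hacc : Tendsto (fun K : ℕ =>
        (account N C pc b Ep (X K) - account N C pc b Ep (X 0)) / K) atTop (𝓝 0) :=
      tendsto_bounded_div (b := (Ep + b / 2) + (Ep + b / 2)) fun k => (abs_sub _ _).trans
        (add_le_add (abs_account_le hpc.1 hb hEp (hE _)) (abs_account_le hpc.1 hb hEp (hE _)))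
    have hexc : Tendsto (fun K : ℕ => (∑ k ∈ Finset.range K,
        if C < (X k).pushed then (1 : ℝ) else 0) / K) atTop (𝓝 0) := by
      refine tendsto_average_of_eventually_eq_zero ?_
      filter_upwards [eventually_pushed_le (B := B) (Ep := Ep) (s₀ := s₀)
        (a := fun k => A k ω) thresholdPolicy_level_le h1] with k hk
      exact if_neg (not_lt.2 hk)
    have hconst : Tendsto (fun K : ℕ => (∑ _k ∈ Finset.range K,
        (t + ((M + Ep) ^ 2 / (2 * b) + 4 * Ep ^ 2 / b))) / (K : ℝ)) atTop
        (𝓝 (t + ((M + Ep) ^ 2 / (2 * b) + 4 * Ep ^ 2 / b))) := by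
      refine tendsto_const_nhds.congr' ?_
      filter_upwards [eventually_ge_atTop 1] with K hK
      have : (K : ℝ) ≠ 0 := by positivity
      simp only [Finset.sum_const, Finset.card_range, nsmul_eq_mul]
      field_simp
    simp only [id, hX.arrival_mean] at h4
    have h := ((((hacc.add h2).sub (h3.const_mul (Ep * (N / (N + pc))))).add
      (h4.const_mul (Ep / b))).add (hexc.const_mul (2 * Ep))).add hconst
    have e : (0 : ℝ) + 0 - Ep * (N / (N + pc)) * 0 + Ep / b * Abar + 2 * Ep * 0 +
        (t + ((M + Ep) ^ 2 / (2 * b) + 4 * Ep ^ 2 / b)) = deficitBound Abar Ep b M t := by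
      unfold deficitBound; ring
    rw [e] at h
    refine h.congr fun K => ?_
    rw [← Finset.sum_range_sub (fun k => account N C pc b Ep (X k))]
    simp only [Finset.sum_add_distrib, Finset.sum_sub_distrib, ← Finset.mul_sum]
    ring

/-- The blocking probability is close to that of the unconstrained system if the battery is
large. -/
theorem eventually_abs_blockedRatio_sub_le (hX : IsSlotProcess P N pu pc v Abar A J R)
    (hN : 1 ≤ N) (hpu : pu ∈ Set.Icc (0 : ℝ) 1) (hpc : pc ∈ Set.Ioc (0 : ℝ) 1) (hCN : C ≤ N)
    (hfeas : pc * C / (N + pc) * Ep ≤ Abar) (hb : 0 < b) (hbB : (b : WithTop ℝ) ≤ B) (hEp : 0 < Ep)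
    (hM : 0 ≤ M) (hs0 : 0 ≤ s₀.energy) (hs : s₀.pushed ≤ N) {ε : ℝ} (hε : 0 < ε) :
    ∀ᵐ ω ∂P, ∀ᶠ K in atTop,
      |blockedRatio (thresholdPolicy Ep C) (path B Ep (thresholdPolicy Ep C) s₀ A R ω)
        (fun k => J k ω) K - blockProb N pu v C| ≤
      (N + pc) / (pc * Ep) * deficitBound Abar Ep b M (Abar - ∫ ω, min (A 0 ω) M ∂P) + ε := by
  have hμ := measurable_thresholdPolicy Ep C
  have hlev := level_le_of_le_max (N := N) (thresholdPolicy_level_le (Ep := Ep) (C := C)) hCN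
  filter_upwards [exists_deficit_le (B := B) hX hN hpc hCN hfeas hb hbB hEp hM hs0 hs,
    tendsto_average_balance (B := B) (Ep := Ep) hX hN hμ hlev hs,
    tendsto_blockedRatio_sub (B := B) (Ep := Ep) hX hN hμ hlev hs,
    hX.frequently_replaced hN hpc.1 (i := 1) (by simp [hN])] with ω h1 h2 h3 h4
  obtain ⟨u, hu, h5⟩ := h1
  set μ := thresholdPolicy Ep C with hμdef
  set X := path B Ep μ s₀ A R ω with hXdef
  have hexc : Tendsto (fun K : ℕ => (∑ k ∈ Finset.range K,
      if C < (X k).pushed then (1 : ℝ) else 0) / K) atTop (𝓝 0) := by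
    refine tendsto_average_of_eventually_eq_zero ?_
    filter_upwards [eventually_pushed_le (B := B) (Ep := Ep) (s₀ := s₀)
      (a := fun k => A k ω) thresholdPolicy_level_le h4] with k hk
    exact if_neg (not_lt.2 hk)
  have hpc0 := hpc.1
  have h6 := ((h5.const_mul ((N + pc) / (pc * Ep))).add ((h2.const_mul (1 / pc)).add
    ((hexc.const_mul ((N : ℝ) + 1)).add h3.abs)))
  simp only [mul_zero, add_zero, abs_zero] at h6
  filter_upwards [h6.eventually_le_const (lt_add_of_pos_right _ hε), eventually_ge_atTop 1]
    with K hK hK1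
  refine le_trans ?_ hK
  have hK0 : (0 : ℝ) < K := by exact_mod_cast hK1
  set g := blockProb N pu v with hg
  have h7 : blockedRatio μ X (fun k => J k ω) K - g C =
      (∑ k ∈ Finset.range K, (g (level μ (X k)) - g C)) / K +
      (blockedRatio μ X (fun k => J k ω) K - (∑ k ∈ Finset.range K, g (level μ (X k))) / K) := by
    rw [Finset.sum_sub_distrib]
    simp only [Finset.sum_const, Finset.card_range, nsmul_eq_mul]
    field_simp
    ring
  have hslot : ∀ k, |g (level μ (X k)) - g C| ≤ (N + pc) / (pc * Ep) * u k +
      1 / pc * ((N + pc) * (pushes (μ (X k)) : ℝ) - pc * level μ (X k)) +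
      (N + 1) * (if C < (X k).pushed then 1 else 0) := by
    intro k
    have hl : level μ (X k) ≤ N := hlev _ (trajectory_pushed_le hlev hs _ _ k)
    have hlC := thresholdPolicy_level_le (Ep := Ep) (C := C) (X k)
    have hu' : (N + pc) / (pc * Ep) * (Ep * (pc * C / (N + pc) - pushes (μ (X k)))) ≤
        (N + pc) / (pc * Ep) * u k := mul_le_mul_of_nonneg_left (hu k) (by positivity)
    -- The balance of pushes and losses converts missing pushes into missing level.
    have e : (N + pc) / (pc * Ep) * (Ep * (pc * C / (N + pc) - pushes (μ (X k)))) +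
        1 / pc * ((N + pc) * (pushes (μ (X k)) : ℝ) - pc * level μ (X k)) =
        C - level μ (X k) := by
      field_simp
      ring
    have hl' : (level μ (X k) : ℝ) ≤ N := by exact_mod_cast hl
    have g1 := blockProb_mem_Icc (v := v) hN hpu hl
    have g2 := blockProb_mem_Icc (v := v) hN hpu hCN
    have hgg : |g (level μ (X k)) - g C| ≤ 1 := by
      rw [abs_le]
      constructor <;> linarith [g1.1, g1.2, g2.1, g2.2]
    -- `g` takes values in `[0, 1]` at these levels, and levels are integers: a level below `C` is
    -- short by at least one, which dominates the error.
    have hmain : |g (level μ (X k)) - g C| ≤ (C - level μ (X k)) +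
        (N + 1) * (if C < (X k).pushed then 1 else 0) := by
      split_ifs with h
      · have : (0 : ℝ) ≤ C := Nat.cast_nonneg _
        linarith
      · rw [max_eq_right (not_lt.1 h)] at hlC
        rcases hlC.eq_or_lt with h8 | h8
        · rw [h8]; simp
        · have : (level μ (X k) : ℝ) + 1 ≤ C := by exact_mod_cast h8
          linarith
    linarith
  have hsum := Finset.sum_le_sum fun k (_ : k ∈ Finset.range K) => hslot k
  rw [h7]
  refine (abs_add_le _ _).trans ?_
  rw [abs_div, abs_of_pos hK0]
  have h8 := (Finset.abs_sum_le_sum_abs (fun k => g (level μ (X k)) - g C)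
    (Finset.range K)).trans hsum
  have h9 := div_le_div_of_nonneg_right h8 hK0.le
  simp only [Finset.sum_add_distrib, ← Finset.mul_sum] at h9
  rw [add_div, add_div] at h9
  simp only [mul_div_assoc] at h9 ⊢
  linarith

end Asymptotics

/-! ### Existence of the limit for a finite battery. -/

section FiniteBattery

variable {Ω : Type*} [MeasurableSpace Ω] {P : Measure Ω} [IsProbabilityMeasure P] {N C : ℕ}
  {pu pc v Abar : ℝ} {A : ℕ → Ω → ℝ} {J R : ℕ → Ω → ℕ} {B Ep : ℝ} {s₀ : State}

/-- States that the threshold policy does not leave when the battery has capacity `B`. -/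
def operatingRegion (B : ℝ) (C : ℕ) : Set State :=
  {s | 0 ≤ s.energy ∧ s.energy ≤ B ∧ s.pushed ≤ C}

lemma measurableSet_operatingRegion (B : ℝ) (C : ℕ) : MeasurableSet (operatingRegion B C) :=
  (measurableSet_le measurable_const measurable_energy).inter
    ((measurableSet_le measurable_energy measurable_const).inter
      (measurableSet_le measurable_pushed measurable_const))

lemma slotStep_mem_operatingRegion (hB : 0 ≤ B) {s : State} (hs : s ∈ operatingRegion B C)
    {z : ℝ × ℕ × ℕ} (hz : 0 ≤ z.1) :
    slotStep B Ep (thresholdPolicy Ep C) (s, z) ∈ operatingRegion B C := by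
  obtain ⟨h1, h2, h3⟩ := hs
  refine ⟨store_nonneg hB le_rfl ?_, min_le_left _ _, ?_⟩
  · have := energyUse_thresholdPolicy_le (C := C) (Ep := Ep) h1
    simp only
    linarith
  · exact (nextPushed_le _ _ _).trans ((thresholdPolicy_level_le (Ep := Ep) s).trans
      (max_le h3 le_rfl))

lemma slotStep_of_not_hit {E α : ℝ} {c j r : ℕ} (h : ¬ (1 ≤ r ∧ r ≤ c)) :
    slotStep (B : WithTop ℝ) Ep (thresholdPolicy Ep C) (⟨E, c⟩, (α, j, r)) =
      if c < C ∧ Ep ≤ E then ⟨min B (E - Ep + α), c + 1⟩ else ⟨min B (E + α), c⟩ := by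
  unfold slotStep step thresholdPolicy
  split_ifs <;> simp [store, energyUse, nextPushed, h]

lemma trajectory_energy_le (hs : s₀.energy ≤ B) (μ : State → Action) (a : ℕ → ℝ) (r : ℕ → ℕ)
    (k : ℕ) : (trajectory (B : WithTop ℝ) Ep μ s₀ a r k).energy ≤ B := by
  cases k with
  | zero => exact hs
  | succ k => exact min_le_left _ _

/-- The Poisson equation writes `blockProb - c` at the current level as `h` minus its one-step mean.
The strong law replaces that mean by `h` at the next state, and the sum telescopes. Every path
enters the operating region after finitely many slots, so the same `c` serves all initial states. -/
lemma exists_blocking_of_atom (hX : IsSlotProcess P N pu pc v Abar A J R) (hN : 1 ≤ N)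
    (hpu : pu ∈ Set.Icc (0 : ℝ) 1) (hpc : 0 < pc) (hCN : C ≤ N) (hB : 0 < B)
    {a : State} (ha : a ∈ operatingRegion B C) {G : Set (ℝ × ℕ × ℕ)} (hG : MeasurableSet G)
    (hG0 : slotLaw P A J R G ≠ 0) (hGnonneg : ∀ z ∈ G, 0 ≤ z.1) {ρ : State → ℕ} {m : ℕ}
    (hρ : ∀ s ∈ operatingRegion B C, ∀ z ∈ G, slotStep B Ep (thresholdPolicy Ep C) (s, z) = a ∨
      ρ (slotStep B Ep (thresholdPolicy Ep C) (s, z)) < ρ s)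
    (hm : ∀ s ∈ operatingRegion B C, ρ s < m) :
    ∃ p : ℝ, ∀ s₀ : State, 0 ≤ s₀.energy → s₀.energy ≤ B → s₀.pushed ≤ N → ∀ᵐ ω ∂P,
      Tendsto (blockedRatio (thresholdPolicy Ep C)
        (path (B : WithTop ℝ) Ep (thresholdPolicy Ep C) s₀ A R ω) (fun k => J k ω))
        atTop (𝓝 p) := by
  have hν := hX.isProbabilityMeasure_slotLaw
  have hμ := measurable_thresholdPolicy Ep C
  have hlev := level_le_of_le_max (N := N) (thresholdPolicy_level_le (Ep := Ep) (C := C)) hCN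
  have hF := measurable_slotStep (B : WithTop ℝ) Ep hμ
  set F := slotStep (B : WithTop ℝ) Ep (thresholdPolicy Ep C) with hFdef
  -- The cap at `N` keeps the function in `[0, 1]` for all states; it has no effect on the path.
  have hf : Measurable fun s => blockProb N pu v (min (level (thresholdPolicy Ep C) s) N) :=
    (Measurable.of_discrete (f := fun l => blockProb N pu v (min l N))).comp (measurable_level hμ)
  obtain ⟨c, h, b, hh, hhb, hpoisson⟩ := exists_poisson (ν := slotLaw P A J R) hF
    (measurableSet_operatingRegion B C) (measurableSet_singleton_state a) ha
    (fun s hs => hX.slotLaw_arrival_nonneg.mono fun z hz =>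
      slotStep_mem_operatingRegion hB.le hs hz) hG hG0
    (fun s hs z hz => (hρ s hs z hz).imp_right fun h =>
      ⟨slotStep_mem_operatingRegion hB.le hs (hGnonneg z hz), h⟩) hm hf
    (fun s => (blockProb_mem_Icc hN hpu (min_le_right _ _)).1)
    (fun s => (blockProb_mem_Icc hN hpu (min_le_right _ _)).2)
  refine ⟨c, fun s₀ hs0 hsB hs => ?_⟩
  filter_upwards [tendsto_blockedRatio_sub (B := (B : WithTop ℝ)) (Ep := Ep) hX hN hμ hlev hs,
    tendsto_average_path (B := (B : WithTop ℝ)) (Ep := Ep) hX hN hμ s₀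
      (φ := fun y => h (F y)) (hh.comp hF) (fun y => hhb _),
    hX.frequently_replaced hN hpc (i := 1) (by simp [hN])] with ω h1 h2 h3
  set X := path (B : WithTop ℝ) Ep (thresholdPolicy Ep C) s₀ A R ω with hXdef
  have hnext : ∀ k, F (X k, slot A J R k ω) = X (k + 1) := fun k => rfl
  have hbd : Tendsto (fun K : ℕ => (h (X K) - h (X 0)) / K) atTop (𝓝 0) :=
    tendsto_bounded_div (b := b + b) fun k => (abs_sub _ _).trans (add_le_add (hhb _) (hhb _))
  have hev : ∀ᶠ k in atTop, blockProb N pu v (level (thresholdPolicy Ep C) (X k)) - c -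
      (h (X k) - ∫ z, h (F (X k, z)) ∂slotLaw P A J R) = 0 := by
    filter_upwards [eventually_pushed_le (B := (B : WithTop ℝ)) (Ep := Ep) (s₀ := s₀)
      (a := fun k => A k ω) thresholdPolicy_level_le h3] with k hk
    have hmem : X k ∈ operatingRegion B C :=
      ⟨trajectory_energy_nonneg hB.le le_rfl hs0 (fun k => hX.arrival_nonneg k ω) _ k,
        trajectory_energy_le hsB _ _ _ k, hk⟩
    have hl : level (thresholdPolicy Ep C) (X k) ≤ N := hlev _ (trajectory_pushed_le hlev hs _ _ k)
    have := hpoisson _ hmem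
    rw [min_eq_left hl] at this
    rw [this, sub_self]
  have hsum := ((h1.add (tendsto_average_of_eventually_eq_zero hev)).add h2).sub hbd
  simp only [add_zero, sub_zero] at hsum
  have hfin := hsum.add_const c
  simp only [zero_add] at hfin
  refine hfin.congr' ?_
  filter_upwards [eventually_ge_atTop 1] with K hK
  have hK0 : (K : ℝ) ≠ 0 := by positivity
  rw [← Finset.sum_range_sub (fun k => h (X k))]
  simp only [hnext, Finset.sum_sub_distrib, Finset.sum_const, Finset.card_range, nsmul_eq_mul]
  field_simp
  ring

/-- If no push can be powered, then every request is blocked. -/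
lemma tendsto_blockedRatio_of_no_push (hX : IsSlotProcess P N pu pc v Abar A J R) (hN : 1 ≤ N)
    (hpu : pu ∈ Set.Icc (0 : ℝ) 1) (hpc : 0 < pc) {B : WithTop ℝ} {μ : State → Action}
    (hμ : Measurable μ) (hlev : ∀ s : State, s.pushed ≤ N → level μ s ≤ N) (hs : s₀.pushed ≤ N)
    (hno : ∀ ω k, pushes (μ (path B Ep μ s₀ A R ω k)) = 0) :
    ∀ᵐ ω ∂P, Tendsto (blockedRatio μ (path B Ep μ s₀ A R ω) (fun k => J k ω)) atTop (𝓝 pu) := by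
  filter_upwards [tendsto_blockedRatio_sub (B := B) (Ep := Ep) hX hN hμ hlev hs,
    tendsto_average_balance (B := B) (Ep := Ep) hX hN hμ hlev hs] with ω h1 h2
  set X := path B Ep μ s₀ A R ω with hXdef
  have h3 := h2.const_mul (-1 / pc)
  rw [mul_zero] at h3
  -- Without pushes the balance forces the mean level to zero, and the gap `pu - blockProb` at a
  -- level is at most that level.
  have h4 : Tendsto (fun K : ℕ => (∑ k ∈ Finset.range K,
      (pu - blockProb N pu v (level μ (X k)))) / (K : ℝ)) atTop (𝓝 0) := by
    refine squeeze_zero (fun K => div_nonneg (Finset.sum_nonneg fun k _ => ?_) (Nat.cast_nonneg K))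
      (fun K => ?_) h3
    · have := blockProb_anti (N := N) (v := v) hpu.1 (Nat.zero_le (level μ (X k)))
      rw [blockProb_zero] at this
      linarith
    · rw [← mul_div_assoc, Finset.mul_sum]
      gcongr with k _
      have hno' : pushes (μ (X k)) = 0 := hno ω k
      have hl : level μ (X k) ≤ N := hlev _ (trajectory_pushed_le hlev hs _ _ k)
      have e : -1 / pc * ((N + pc) * (pushes (μ (X k)) : ℝ) - pc * level μ (X k)) =
          level μ (X k) := by
        rw [hno']; field_simp; simp
      rw [e]
      rcases Nat.eq_zero_or_pos (level μ (X k)) with h | h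
      · simp [h, blockProb_zero]
      · have h5 : (1 : ℝ) ≤ level μ (X k) := by exact_mod_cast h
        have := (blockProb_mem_Icc (v := v) hN hpu hl).1
        linarith [hpu.2]
  have h5 := (h1.sub h4).add_const pu
  simp only [sub_zero, zero_add] at h5
  refine h5.congr' ?_
  filter_upwards [eventually_ge_atTop 1] with K hK
  have hK0 : (K : ℝ) ≠ 0 := by positivity
  simp only [Finset.sum_sub_distrib, Finset.sum_const, Finset.card_range, nsmul_eq_mul]
  field_simp
  ring

lemma ceil_lt_ceil_of_le_sub_one {x y : ℝ} (hx : 0 ≤ x) (h : x ≤ y - 1) : ⌈x⌉₊ < ⌈y⌉₊ :=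
  Nat.lt_ceil.2 (by linarith [Nat.ceil_lt_add_one hx])

lemma measure_lt_arrival_ne_zero (hX : IsSlotProcess P N pu pc v Abar A J R) {x : ℝ}
    (hx : x < Abar) : P (A 0 ⁻¹' Set.Ioi x) ≠ 0 := by
  intro h
  have h1 : ∀ᵐ ω ∂P, A 0 ω ≤ x := by
    rw [ae_iff]
    convert h using 2
    ext ω
    simp
  have h2 := integral_mono_ae hX.arrival_integrable (integrable_const x) h1
  rw [hX.arrival_mean] at h2
  simp at h2
  linarith

/-- If some replacements spare the stored contents, then the full battery together with `C` stored
contents is an atom. -/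
lemma exists_blocking_of_mul_lt (hX : IsSlotProcess P N pu pc v Abar A J R) (hN : 1 ≤ N)
    (hpu : pu ∈ Set.Icc (0 : ℝ) 1) (hpc : 0 < pc) (hCN : C ≤ N) (hEp : 0 < Ep) (hEB : Ep ≤ B)
    (hA : 0 < Abar) (hlt : pc * C < N) :
    ∃ p : ℝ, ∀ s₀ : State, 0 ≤ s₀.energy → s₀.energy ≤ B → s₀.pushed ≤ N → ∀ᵐ ω ∂P,
      Tendsto (blockedRatio (thresholdPolicy Ep C)
        (path (B : WithTop ℝ) Ep (thresholdPolicy Ep C) s₀ A R ω) (fun k => J k ω))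
        atTop (𝓝 p) := by
  have hB : 0 < B := hEp.trans_le hEB
  -- Arrivals above half the mean have positive probability; one unit of the energy rank stands for
  -- `e`.
  set e := Abar / 2 with he
  have he0 : 0 < e := by positivity
  have hN0 : (0 : ℝ) < N := by exact_mod_cast hN
  have hR : P (R 0 ⁻¹' {r | ¬ (1 ≤ r ∧ r ≤ C)}) ≠ 0 := by
    have h1 := hX.replaced_mem_Icc hCN
    have h2 : P.real {ω | 1 ≤ R 0 ω ∧ R 0 ω ≤ C}ᶜ = 1 - pc * C / N := by
      rw [probReal_compl_eq_one_sub, h1]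
      exact hX.measurable_replaced 0 (MeasurableSet.of_discrete (s := {r | 1 ≤ r ∧ r ≤ C}))
    intro h
    have h3 : P.real {ω | 1 ≤ R 0 ω ∧ R 0 ω ≤ C}ᶜ = 0 := by
      rw [measureReal_def]
      have : P {ω | 1 ≤ R 0 ω ∧ R 0 ω ≤ C}ᶜ = 0 := h
      rw [this]; rfl
    have h4 : pc * C / N < 1 := by rw [div_lt_one hN0]; exact hlt
    linarith
  -- `n` exceeds every energy rank in the region, so the rank below is lexicographic: missing
  -- contents first, then missing energy.
  set n := ⌈B / e⌉₊ + 1 with hn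
  have hceil : ∀ x, 0 ≤ x → ⌈(B - x) / e⌉₊ < n := fun x hx =>
    Nat.lt_succ_of_le (Nat.ceil_mono (by gcongr; linarith))
  refine exists_blocking_of_atom hX hN hpu hpc hCN hB (a := ⟨B, C⟩)
    ⟨hB.le, le_rfl, le_rfl⟩
    (G := {z | z.1 ∈ Set.Ioi e ∧ z.2.2 ∈ {r | ¬ (1 ≤ r ∧ r ≤ C)}})
    (IsSlotProcess.measurableSet_arrival_replaced measurableSet_Ioi _)
    (hX.slotLaw_arrival_replaced measurableSet_Ioi
      (measure_lt_arrival_ne_zero hX (by linarith)) hR)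
    (fun z hz => (he0.trans hz.1).le)
    (ρ := fun s => (C - s.pushed) * n + ⌈(B - s.energy) / e⌉₊) (m := C * n + n) ?_ ?_
  · rintro ⟨E, c⟩ ⟨h1, h2, h3⟩ ⟨α, j, r⟩ ⟨h4, h5⟩
    simp only at h1 h2 h3
    have h4' : e < α := h4
    have hnohit : ¬ (1 ≤ r ∧ r ≤ c) := fun h => h5 ⟨h.1, h.2.trans h3⟩
    rw [slotStep_of_not_hit hnohit]
    split_ifs with h
    · right
      simp only
      obtain ⟨d, hd⟩ : ∃ d, C - c = d + 1 := ⟨C - c - 1, by omega⟩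
      have hd' : C - (c + 1) = d := by omega
      have := hceil (min B (E - Ep + α)) (le_min hB.le (by linarith [h.2]))
      rw [hd, hd', add_mul, one_mul]
      omega
    · rcases le_total B (E + α) with h6 | h6
      · rw [min_eq_left h6]
        rcases h3.eq_or_lt with h7 | h7
        · left; rw [h7]
        · right
          -- A slot that sleeps below `C` starts with less than `Ep ≤ B`, so reaching the full
          -- battery strictly lowers the energy rank.
          have h8 : E < Ep := by
            by_contra h8
            exact h ⟨h7, not_lt.1 h8⟩
          have : 0 < ⌈(B - E) / e⌉₊ := Nat.ceil_pos.2 (div_pos (by linarith) he0)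
          simp only [sub_self, zero_div, Nat.ceil_zero]
          omega
      · right
        rw [min_eq_right h6]
        have := ceil_lt_ceil_of_le_sub_one (x := (B - (E + α)) / e) (y := (B - E) / e)
          (div_nonneg (by linarith) he0.le) (by
            rw [le_sub_iff_add_le, div_add_one he0.ne']
            gcongr; linarith)
        simp only
        omega
  · rintro s ⟨h1, h2, h3⟩
    have h4 := hceil s.energy h1
    have h5 : (C - s.pushed) * n ≤ C * n := Nat.mul_le_mul_right _ (Nat.sub_le _ _)
    omega

/-- If every replacement hits a stored content, the battery still fills up when arrivals of more
than `Ep / 2` occur. -/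
lemma exists_blocking_of_mul_eq (hX : IsSlotProcess P N pu pc v Abar A J R) (hN : 1 ≤ N)
    (hpu : pu ∈ Set.Icc (0 : ℝ) 1) (hpc : 0 < pc) (hEp : 0 < Ep) (hEB : Ep ≤ B) {x : ℝ}
    (hx : Ep / 2 < x) (hA : P (A 0 ⁻¹' Set.Ioi x) ≠ 0) :
    ∃ p : ℝ, ∀ s₀ : State, 0 ≤ s₀.energy → s₀.energy ≤ B → s₀.pushed ≤ N → ∀ᵐ ω ∂P,
      Tendsto (blockedRatio (thresholdPolicy Ep N)
        (path (B : WithTop ℝ) Ep (thresholdPolicy Ep N) s₀ A R ω) (fun k => J k ω))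
        atTop (𝓝 p) := by
  have hB : 0 < B := hEp.trans_le hEB
  set e := x - Ep / 2 with he
  have he0 : 0 < e := by linarith
  have hN0 : (0 : ℝ) < N := by exact_mod_cast hN
  have hR : P (R 0 ⁻¹' {N}) ≠ 0 := by
    have h1 := hX.replaced_rank 0 N (by simp [hN])
    intro h
    have h2 : P {ω | R 0 ω = N} = 0 := h
    rw [measureReal_def, h2, ENNReal.toReal_zero] at h1
    have : 0 < pc * (1 / N) := by positivity
    linarith
  set n := ⌈(B + Ep / 2) / e⌉₊ + 1 with hn
  have hceil : ∀ y, 0 ≤ y → ⌈(B + Ep / 2 - y) / e⌉₊ < n := fun x hx =>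
    Nat.lt_succ_of_le (Nat.ceil_mono (by gcongr; linarith))
  have hdec : ∀ y y', y + e ≤ y' → y' ≤ B + Ep / 2 →
      ⌈(B + Ep / 2 - y') / e⌉₊ < ⌈(B + Ep / 2 - y) / e⌉₊ := fun y y' h h' =>
    ceil_lt_ceil_of_le_sub_one (div_nonneg (by linarith) he0.le) (by
      rw [le_sub_iff_add_le, div_add_one he0.ne']
      gcongr; linarith)
  have htop : ∀ y, y < B + Ep / 2 → ⌈(B + Ep / 2 - (B + Ep / 2)) / e⌉₊ <
      ⌈(B + Ep / 2 - y) / e⌉₊ := fun y h => by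
    simp only [sub_self, zero_div, Nat.ceil_zero]
    exact Nat.ceil_pos.2 (div_pos (by linarith) he0)
  -- Once the count alternates between `N - 1` and `N`, a push is paid every other slot. The bonus
  -- `Ep / 2` at `N` spreads this cost, so that `W` gains at least `e` in each slot. The second case
  -- of the bonus concerns states whose next slot pushes and lowers the count rank anyway; it lets a
  -- full battery attain the maximum `B + Ep / 2`.
  set W : ℝ → ℕ → ℝ := fun E c =>
    E + if c = N ∨ c + 1 < N ∧ Ep ≤ E then Ep / 2 else 0 with hW
  have hW0 : ∀ E c, 0 ≤ E → 0 ≤ W E c := fun E c h => by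
    simp only [hW]; split_ifs <;> linarith
  -- Replacing rank `N` removes a content only from a full store. The truncated difference `N - 1 -
  -- pushed` is zero at both `N - 1` and `N`, so the alternation does not disturb the count rank.
  refine exists_blocking_of_atom hX hN hpu hpc le_rfl hB (a := ⟨B, N - 1⟩)
    ⟨hB.le, le_rfl, Nat.sub_le _ _⟩
    (G := {z | z.1 ∈ Set.Ioi x ∧ z.2.2 ∈ ({N} : Set ℕ)})
    (IsSlotProcess.measurableSet_arrival_replaced measurableSet_Ioi _)
    (hX.slotLaw_arrival_replaced measurableSet_Ioi hA hR)
    (fun z hz => by have : x < z.1 := hz.1; linarith)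
    (ρ := fun s => (N - 1 - s.pushed) * n + ⌈(B + Ep / 2 - W s.energy s.pushed) / e⌉₊)
    (m := N * n + n) ?_ ?_
  · rintro ⟨E, c⟩ ⟨h1, h2, h3⟩ ⟨α, j, r⟩ ⟨h4, h5⟩
    simp only at h1 h2 h3
    have h4' : x < α := h4
    have h5' : r = N := h5
    subst h5'
    rcases h3.lt_or_eq with hc | hc
    · have hnohit : ¬ (1 ≤ r ∧ r ≤ c) := by omega
      rw [slotStep_of_not_hit hnohit]
      simp only [hc, true_and]
      split_ifs with h
      · right
        simp only
        have hE'0 : 0 ≤ min B (E - Ep + α) := le_min hB.le (by linarith)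
        rcases Nat.lt_or_ge (c + 1) r with h6 | h6
        · obtain ⟨d, hd⟩ : ∃ d, r - 1 - c = d + 1 := ⟨r - 1 - c - 1, by omega⟩
          have hd' : r - 1 - (c + 1) = d := by omega
          have := hceil (W (min B (E - Ep + α)) (c + 1)) (hW0 _ _ hE'0)
          rw [hd, hd', add_mul, one_mul]
          omega
        · have h7 : c + 1 = r := by omega
          have e1 : r - 1 - (c + 1) = r - 1 - c := by omega
          have e2 : W E c = E := by
            simp only [hW]; rw [if_neg (by omega), add_zero]
          have e3 : ∀ E', W E' (c + 1) = E' + Ep / 2 := fun E' => by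
            simp only [hW]; rw [if_pos (Or.inl h7)]
          rw [e1, e2, e3]
          rcases le_total B (E - Ep + α) with h8 | h8
          · rw [min_eq_left h8]
            have := htop E (by linarith)
            omega
          · rw [min_eq_right h8]
            have := hdec E (E - Ep + α + Ep / 2) (by linarith) (by linarith)
            omega
      · have hEW : W E c = E := by
          simp only [hW]; rw [if_neg, add_zero]
          rintro (h' | h')
          · omega
          · exact h h'.2
        push Not at h
        rcases le_total B (E + α) with h6 | h6
        · rw [min_eq_left h6]
          rcases Nat.lt_or_ge (c + 1) r with h7 | h7
          · right
            have e2 : W B c = B + Ep / 2 := by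
              simp only [hW]; rw [if_pos (Or.inr ⟨h7, hEB⟩)]
            have := htop E (by linarith)
            simp only
            rw [hEW, e2]
            omega
          · left
            have : c = r - 1 := by omega
            rw [this]
        · right
          rw [min_eq_right h6]
          have h7 : E + α ≤ W (E + α) c := by
            simp only [hW]; split_ifs <;> linarith
          have h8 : W (E + α) c ≤ B + Ep / 2 := by
            simp only [hW]; split_ifs <;> linarith
          have := hdec E (W (E + α) c) (by linarith) h8
          simp only
          rw [hEW]
          omega
    · subst hc
      have hstep : slotStep B Ep (thresholdPolicy Ep c) (⟨E, c⟩, (α, j, c)) =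
          ⟨min B (E + α), c - 1⟩ := by
        unfold slotStep step thresholdPolicy
        simp [store, energyUse, nextPushed, hN]
      rw [hstep]
      rcases le_total B (E + α) with h6 | h6
      · left; rw [min_eq_left h6]
      · right
        rw [min_eq_right h6]
        have e1 : W E c = E + Ep / 2 := by
          simp [hW]
        have e2 : W (E + α) (c - 1) = E + α := by
          simp only [hW]; rw [if_neg (by omega), add_zero]
        have := hdec (E + Ep / 2) (E + α) (by linarith) (by linarith)
        simp only
        rw [e1, e2]
        have e3 : c - 1 - c = 0 := by omega
        have e4 : c - 1 - (c - 1) = 0 := by omega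
        rw [e3, e4]
        omega
  · rintro s ⟨h1, h2, h3⟩
    have h4 := hceil (W s.energy s.pushed) (hW0 _ _ h1)
    have h5 : (N - 1 - s.pushed) * n ≤ N * n := Nat.mul_le_mul_right _ (by omega)
    omega

end FiniteBattery

/-! ### The deterministic boundary case. -/

section SingleContent

variable {B Ep : ℝ} {s₀ : State} {a : ℕ → ℝ} {r : ℕ → ℕ}

/-- A single content that is replaced in every slot, and arrivals of exactly `Ep / 2`. -/
lemma eventually_level_eq_one (hEp : 0 < Ep) (hEB : Ep ≤ B) (ha : ∀ k, a k = Ep / 2)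
    (hr : ∀ k, r k = 1) (hs0 : 0 ≤ s₀.energy) (hs : s₀.pushed ≤ 1) :
    ∀ᶠ k in atTop, level (thresholdPolicy Ep 1)
      (trajectory (B : WithTop ℝ) Ep (thresholdPolicy Ep 1) s₀ a r k) = 1 := by
  set X := trajectory (B : WithTop ℝ) Ep (thresholdPolicy Ep 1) s₀ a r with hX
  have hnext : ∀ k, X (k + 1) = step B Ep (X k) (thresholdPolicy Ep 1 (X k)) (a k) (r k) :=
    fun k => rfl
  -- The invariant two-slot cycle: push with at least `Ep`, keep at least `Ep / 2`, then sleep while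
  -- the content is lost and the battery regains `Ep`. It is entered by slot 3.
  let good : State → Prop := fun s =>
    s.pushed = 0 ∧ Ep ≤ s.energy ∨ s.pushed = 1 ∧ Ep / 2 ≤ s.energy
  have hpush : ∀ k, (X k).pushed = 0 → Ep ≤ (X k).energy →
      X (k + 1) = ⟨min B ((X k).energy - Ep + Ep / 2), 1⟩ := fun k h1 h2 => by
    rw [hnext, thresholdPolicy, if_pos ⟨by omega, h2⟩, ha, hr]
    simp [step, store, energyUse, nextPushed, h1]
  have hsleep : ∀ k, (X k).pushed = 0 → (X k).energy < Ep →
      X (k + 1) = ⟨min B ((X k).energy + Ep / 2), 0⟩ := fun k h1 h2 => by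
    rw [hnext, thresholdPolicy, if_neg (fun h => absurd h.2 (not_le.2 h2)), ha, hr]
    simp [step, store, energyUse, nextPushed, h1]
  have hfull : ∀ k, (X k).pushed = 1 →
      X (k + 1) = ⟨min B ((X k).energy + Ep / 2), 0⟩ := fun k h1 => by
    rw [hnext, thresholdPolicy, if_neg (fun h => by omega), ha, hr]
    simp [step, store, energyUse, nextPushed, h1]
  have hstay : ∀ k, good (X k) → good (X (k + 1)) := by
    rintro k (⟨h1, h2⟩ | ⟨h1, h2⟩)
    · rw [hpush k h1 h2]
      exact Or.inr ⟨rfl, le_min (by linarith) (by linarith)⟩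
    · rw [hfull k h1]
      exact Or.inl ⟨rfl, le_min hEB (by linarith)⟩
  have hE : ∀ k, 0 ≤ (X k).energy := fun k => trajectory_energy_nonneg (b := B)
    (hEp.le.trans hEB) le_rfl hs0 (fun k => by rw [ha]; positivity) r k
  have h1 : good (X 1) ∨ (X 1).pushed = 0 := by
    rcases Nat.le_one_iff_eq_zero_or_eq_one.1 hs with h | h
    · rcases le_or_gt Ep (X 0).energy with h' | h'
      · exact Or.inl (hstay 0 (Or.inl ⟨h, h'⟩))
      · right; rw [hsleep 0 h h']
    · right; rw [hfull 0 h]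
  have h2 : ∀ k, (X k).pushed = 0 → good (X (k + 1)) ∨
      (X (k + 1)).pushed = 0 ∧ Ep / 2 ≤ (X (k + 1)).energy := fun k h => by
    rcases le_or_gt Ep (X k).energy with h' | h'
    · exact Or.inl (hstay k (Or.inl ⟨h, h'⟩))
    · right
      rw [hsleep k h h']
      exact ⟨rfl, le_min (by linarith) (by have := hE k; linarith)⟩
  have h3 : ∀ k, (X k).pushed = 0 → Ep / 2 ≤ (X k).energy → good (X (k + 1)) := fun k h hk => by
    rcases le_or_gt Ep (X k).energy with h' | h'
    · exact hstay k (Or.inl ⟨h, h'⟩)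
    · rw [hsleep k h h']
      exact Or.inl ⟨rfl, le_min hEB (by linarith)⟩
  have h4 : good (X 3) := by
    rcases h1 with h | h
    · exact hstay 2 (hstay 1 h)
    · rcases h2 1 h with h' | h'
      · exact hstay 2 h'
      · exact h3 2 h'.1 h'.2
  have h5 : ∀ k ≥ 3, good (X k) := fun k hk => Nat.le_induction h4 (fun l _ => hstay l) k hk
  refine eventually_atTop.2 ⟨3, fun k hk => ?_⟩
  rw [level, pushes_thresholdPolicy]
  rcases h5 k hk with ⟨h, h'⟩ | ⟨h, h'⟩
  · rw [if_pos ⟨by omega, h'⟩, h]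
  · rw [if_neg (fun h'' => by omega), h]

end SingleContent

/-! ### Existence, the large-capacity limit and infinite capacity. -/

section Main

variable {Ω : Type*} [MeasurableSpace Ω] {P : Measure Ω} [IsProbabilityMeasure P] {N C : ℕ}
  {pu pc v Abar : ℝ} {A : ℕ → Ω → ℝ} {J R : ℕ → Ω → ℕ} {B Ep : ℝ}

omit [IsProbabilityMeasure P] in
lemma exists_lt_measure_Ioi_ne_zero {X : Ω → ℝ} {x : ℝ} (h : P (X ⁻¹' Set.Ioi x) ≠ 0) :
    ∃ y, x < y ∧ P (X ⁻¹' Set.Ioi y) ≠ 0 := by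
  by_contra hcon
  push Not at hcon
  refine h ?_
  have : X ⁻¹' Set.Ioi x ⊆ ⋃ n : ℕ, X ⁻¹' Set.Ioi (x + 1 / (n + 1)) := by
    intro ω hω
    have hω' : x < X ω := hω
    obtain ⟨n, hn⟩ := exists_nat_one_div_lt (sub_pos.2 hω')
    exact Set.mem_iUnion.2 ⟨n, show x + 1 / (n + 1) < X ω by linarith⟩
  exact measure_mono_null this (measure_iUnion_null fun n =>
    hcon _ (lt_add_of_pos_right _ (by positivity)))

/-- Existence of the long-run blocking probability for finite battery capacity. -/
theorem exists_blocking (hX : IsSlotProcess P N pu pc v Abar A J R) (hN : 1 ≤ N)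
    (hpu : pu ∈ Set.Icc (0 : ℝ) 1) (hpc : pc ∈ Set.Ioc (0 : ℝ) 1) (hCN : C ≤ N) (hEp : 0 < Ep)
    (hfeas : pc * C / (N + pc) * Ep ≤ Abar) :
    ∃ p : ℝ, ∀ s₀ : State, 0 ≤ s₀.energy → s₀.energy ≤ B → s₀.pushed ≤ N → ∀ᵐ ω ∂P,
      Tendsto (blockedRatio (thresholdPolicy Ep C)
        (path (B : WithTop ℝ) Ep (thresholdPolicy Ep C) s₀ A R ω) (fun k => J k ω))
        atTop (𝓝 p) := by
  have hpc0 := hpc.1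
  have hμ := measurable_thresholdPolicy Ep C
  have hlev := level_le_of_le_max (N := N) (thresholdPolicy_level_le (Ep := Ep) (C := C)) hCN
  have hN0 : (0 : ℝ) < N := by exact_mod_cast hN
  by_cases hno : C = 0 ∨ B < Ep
  · refine ⟨pu, fun s₀ _ hsB hs =>
      tendsto_blockedRatio_of_no_push hX hN hpu hpc0 hμ hlev hs fun ω k => ?_⟩
    rw [pushes_thresholdPolicy, if_neg]
    rintro ⟨h1, h2⟩
    rcases hno with h | h
    · omega
    · have := trajectory_energy_le (Ep := Ep) hsB (thresholdPolicy Ep C) (fun k => A k ω)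
        (fun k => R k ω) k
      linarith
  push Not at hno
  obtain ⟨hC0, hEB⟩ := hno
  have hC1 : (1 : ℝ) ≤ C := by exact_mod_cast Nat.one_le_iff_ne_zero.2 hC0
  have hA : 0 < Abar := lt_of_lt_of_le (by positivity) hfeas
  -- Equality `pc * C = N` means `pc = 1` and `C = N`: a full store loses a content in every slot,
  -- so a different atom is needed.
  rcases lt_or_ge (pc * C) N with hlt | hge
  · exact exists_blocking_of_mul_lt hX hN hpu hpc0 hCN hEp hEB hA hlt
  have hC : C = N := by
    have h1 : pc * C ≤ C := mul_le_of_le_one_left (by positivity) hpc.2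
    exact le_antisymm hCN (by exact_mod_cast hge.trans h1)
  subst hC
  by_cases hhalf : P (A 0 ⁻¹' Set.Ioi (Ep / 2)) = 0
  · have hle : ∀ᵐ ω ∂P, A 0 ω ≤ Ep / 2 := by
      rw [ae_iff]
      convert hhalf using 2
      ext ω
      simp
    have hAle : Abar ≤ Ep / 2 := by
      have := integral_mono_ae hX.arrival_integrable (integrable_const (Ep / 2)) hle
      rw [hX.arrival_mean] at this
      simpa using this
    have hpc1 : pc = 1 := by
      have h1 : (1 : ℝ) * C ≤ pc * C := by linarith
      exact le_antisymm hpc.2 (le_of_mul_le_mul_right h1 hN0)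
    subst hpc1
    rw [div_mul_eq_mul_div, div_le_iff₀ (by positivity)] at hfeas
    -- Feasibility now reads `C * Ep / (C + 1) ≤ Abar`, while `Abar ≤ Ep / 2`. This forces `C = 1`
    -- and `Abar = Ep / 2`, hence deterministic arrivals.
    have hC2 : C = 1 := by
      refine le_antisymm ?_ hN
      have h1 : (C : ℝ) * Ep ≤ Ep / 2 * (C + 1) := by nlinarith
      have h2 : (C : ℝ) ≤ 1 := by
        by_contra h
        nlinarith
      exact_mod_cast h2
    subst hC2
    have hAeq : Abar = Ep / 2 := by
      refine le_antisymm hAle ?_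
      push_cast at hfeas
      linarith
    have h0 : ∀ᵐ ω ∂P, A 0 ω = Ep / 2 := by
      have h1 : ∫ ω, (Ep / 2 - A 0 ω) ∂P = 0 := by
        rw [integral_sub (integrable_const _) hX.arrival_integrable, hX.arrival_mean, hAeq]
        simp
      rw [integral_eq_zero_iff_of_nonneg_ae (hle.mono fun ω h => sub_nonneg.2 h)
        ((integrable_const _).sub hX.arrival_integrable)] at h1
      filter_upwards [h1] with ω hω
      simp only [Pi.zero_apply] at hω
      linarith
    have hall : ∀ᵐ ω ∂P, ∀ k, A k ω = Ep / 2 := ae_all_iff.2 fun k =>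
      (hX.arrival_identDistrib k).symm.ae_mem_snd (measurableSet_singleton (Ep / 2)) h0
    have hRall : ∀ᵐ ω ∂P, ∀ k, R k ω = 1 := ae_all_iff.2 fun k => by
      have h1 := hX.replaced_rank k 1 (by simp)
      have h2 : MeasurableSet {ω | R k ω = 1} :=
        hX.measurable_replaced k (measurableSet_singleton 1)
      have h3 : P {ω | R k ω = 1} = 1 := by
        rw [← ofReal_measureReal (μ := P) (s := {ω | R k ω = 1}), h1]
        simp
      exact (mem_ae_iff_prob_eq_one h2).2 h3
    refine ⟨blockProb 1 pu v 1, fun s₀ hs0 hsB hs => ?_⟩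
    refine (tendsto_of_eventually_level (B := (B : WithTop ℝ)) (Ep := Ep) hX hN hpc0 hμ hlev hs
      ?_).mono fun ω h => h.2
    filter_upwards [hall, hRall] with ω h1 h2
    exact eventually_level_eq_one hEp hEB h1 h2 hs0 hs
  · obtain ⟨x, hx, hx'⟩ := exists_lt_measure_Ioi_ne_zero hhalf
    exact exists_blocking_of_mul_eq hX hN hpu hpc0 hEp hEB hx hx'

omit [IsProbabilityMeasure P] in
lemma tendsto_integral_min_arrival (hX : IsSlotProcess P N pu pc v Abar A J R) :
    Tendsto (fun M : ℝ => Abar - ∫ ω, min (A 0 ω) M ∂P) atTop (𝓝 0) := by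
  have h : Tendsto (fun M : ℝ => ∫ ω, min (A 0 ω) M ∂P) atTop (𝓝 (∫ ω, A 0 ω ∂P)) := by
    refine tendsto_integral_filter_of_dominated_convergence (fun ω => A 0 ω)
      (Eventually.of_forall fun M =>
        ((hX.measurable_arrival 0).min measurable_const).aestronglyMeasurable) ?_
      hX.arrival_integrable (ae_of_all _ fun ω => ?_)
    · filter_upwards [eventually_ge_atTop 0] with M hM
      refine ae_of_all _ fun ω => ?_
      rw [Real.norm_eq_abs, abs_of_nonneg (le_min (hX.arrival_nonneg 0 ω) hM)]
      exact min_le_left _ _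
    · refine tendsto_const_nhds.congr' ?_
      filter_upwards [eventually_ge_atTop (A 0 ω)] with M hM
      exact (min_eq_left hM).symm
  rw [hX.arrival_mean] at h
  simpa using h.const_sub Abar

lemma tendsto_deficitBound (Abar Ep M t : ℝ) :
    Tendsto (fun b : ℝ => deficitBound Abar Ep b M t) atTop (𝓝 t) := by
  have h1 : Tendsto (fun b : ℝ => b⁻¹) atTop (𝓝 0) := tendsto_inv_atTop_zero
  have h2 := (h1.mul_const (Ep * Abar + (M + Ep) ^ 2 / 2 + 4 * Ep ^ 2)).const_add t
  rw [zero_mul, add_zero] at h2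
  refine h2.congr fun b => ?_
  unfold deficitBound
  ring

omit [IsProbabilityMeasure P] in
/-- For large `b` the deviation bound is small. -/
lemma exists_deficitBound_lt (hX : IsSlotProcess P N pu pc v Abar A J R)
    {ε : ℝ} (hε : 0 < ε) :
    ∃ M ≥ 0, ∀ᶠ b in atTop,
      (N + pc) / (pc * Ep) * deficitBound Abar Ep b M (Abar - ∫ ω, min (A 0 ω) M ∂P) < ε := by
  have h1 := (tendsto_integral_min_arrival hX).const_mul ((N + pc) / (pc * Ep))
  rw [mul_zero] at h1
  -- The truncation `M` has to be fixed before `b`, since the error contains `(M + Ep) ^ 2 / b`.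
  obtain ⟨M, hM, hM0⟩ := ((h1.eventually_lt_const hε).and (eventually_ge_atTop 0)).exists
  exact ⟨M, hM0, ((tendsto_deficitBound Abar Ep M _).const_mul _).eventually_lt_const hM⟩

/-- The long-run blocking probability for finite capacity approaches that of the unconstrained
system. -/
theorem exists_blocking_tendsto (hX : IsSlotProcess P N pu pc v Abar A J R) (hN : 1 ≤ N)
    (hpu : pu ∈ Set.Icc (0 : ℝ) 1) (hpc : pc ∈ Set.Ioc (0 : ℝ) 1) (hCN : C ≤ N) (hEp : 0 < Ep)
    (hfeas : pc * C / (N + pc) * Ep ≤ Abar) :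
    ∃ p : ℝ → ℝ,
      (∀ B : ℝ, ∀ s₀ : State, 0 ≤ s₀.energy → s₀.energy ≤ B → s₀.pushed ≤ N →
        ∀ᵐ ω ∂P, Tendsto (blockedRatio (thresholdPolicy Ep C)
          (path (B : WithTop ℝ) Ep (thresholdPolicy Ep C) s₀ A R ω) (fun k => J k ω))
          atTop (𝓝 (p B))) ∧
      Tendsto p atTop (𝓝 (blockProb N pu v C)) := by
  choose p hp using fun B : ℝ => exists_blocking (B := B) hX hN hpu hpc hCN hEp hfeas
  refine ⟨p, hp, Metric.tendsto_nhds.2 fun ε hε => ?_⟩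
  obtain ⟨M, hM, hb⟩ := exists_deficitBound_lt (Ep := Ep) hX (half_pos hε)
  filter_upwards [hb, eventually_gt_atTop 0] with B hB hB0
  -- The reference level is the capacity itself. The empty initial state suffices, because `p B` is
  -- the same for all admissible ones.
  obtain ⟨ω, h1, h2⟩ := ((hp B ⟨0, 0⟩ le_rfl hB0.le (Nat.zero_le _)).and
    (eventually_abs_blockedRatio_sub_le (s₀ := ⟨0, 0⟩) hX hN hpu hpc hCN hfeas hB0
      (le_refl (B : WithTop ℝ)) hEp hM le_rfl (Nat.zero_le _) (half_pos hε))).exists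
  have h3 := le_of_tendsto (h1.sub_const (blockProb N pu v C)).abs h2
  rw [Real.dist_eq]
  linarith

/-- Infinite battery capacity. -/
theorem tendsto_blockedRatio_top (hX : IsSlotProcess P N pu pc v Abar A J R) (hN : 1 ≤ N)
    (hpu : pu ∈ Set.Icc (0 : ℝ) 1) (hpc : pc ∈ Set.Ioc (0 : ℝ) 1) (hCN : C ≤ N) (hEp : 0 < Ep)
    (hfeas : pc * C / (N + pc) * Ep ≤ Abar) (s₀ : State) (hs0 : 0 ≤ s₀.energy)
    (hs : s₀.pushed ≤ N) :
    ∀ᵐ ω ∂P, Tendsto (blockedRatio (thresholdPolicy Ep C)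
      (path ⊤ Ep (thresholdPolicy Ep C) s₀ A R ω) (fun k => J k ω)) atTop
      (𝓝 (blockProb N pu v C)) := by
  have h : ∀ᵐ ω ∂P, ∀ n : ℕ, ∀ᶠ K in atTop,
      |blockedRatio (thresholdPolicy Ep C) (path ⊤ Ep (thresholdPolicy Ep C) s₀ A R ω)
        (fun k => J k ω) K - blockProb N pu v C| ≤ 1 / ((n : ℝ) + 1) := by
    refine ae_all_iff.2 fun n => ?_
    have hε : (0 : ℝ) < 1 / ((n : ℝ) + 1) := by positivity
    obtain ⟨M, hM, hb⟩ := exists_deficitBound_lt (Ep := Ep) hX (half_pos hε)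
    -- Under infinite capacity every finite reference level is admissible, so `b` may depend on the
    -- accuracy.
    obtain ⟨b, hb1, hb0⟩ := (hb.and (eventually_gt_atTop 0)).exists
    filter_upwards [eventually_abs_blockedRatio_sub_le hX hN hpu hpc hCN hfeas hb0
      (le_top : (b : WithTop ℝ) ≤ ⊤) hEp hM hs0 hs (half_pos hε)] with ω hω
    filter_upwards [hω] with K hK
    linarith
  filter_upwards [h] with ω hω
  refine Metric.tendsto_nhds.2 fun ε hε => ?_
  obtain ⟨n, hn⟩ := exists_nat_one_div_lt hε
  filter_upwards [hω n] with K hK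
  rw [Real.dist_eq]
  linarith

end Main

end PushPolicy

theorem theorem1 {Ω : Type*} [MeasurableSpace Ω] (P : Measure Ω) [IsProbabilityMeasure P]
    (N : ℕ) (hN : 1 ≤ N) (pu pc v Ep Abar : ℝ)
    (hpu : pu ∈ Set.Icc (0 : ℝ) 1) (hpc : pc ∈ Set.Ioc (0 : ℝ) 1) (hv : 0 ≤ v) (hEp : 0 < Ep)
    (A : ℕ → Ω → ℝ) (J R : ℕ → Ω → ℕ)
    (hX : PushPolicy.IsSlotProcess P N pu pc v Abar A J R)
    (C : ℕ) (hC : C = PushPolicy.potbThreshold N pc Abar Ep)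
    (pblk : ℝ) (hpblk : pblk = pu * (1 - ∑ i ∈ Finset.Icc 1 C, PushPolicy.zipf N v i)) :
    -- finite capacity `B`: the long-run blocking probability `p B` exists and tends to `pblk`
    (∃ p : ℝ → ℝ,
      (∀ B : ℝ, 0 < B → ∀ s₀ : PushPolicy.State,
        0 ≤ s₀.energy → s₀.energy ≤ B → s₀.pushed ≤ N → ∀ᵐ ω ∂P,
          Tendsto (PushPolicy.blockedRatio (PushPolicy.thresholdPolicy Ep C)
            (PushPolicy.trajectory (B : WithTop ℝ) Ep (PushPolicy.thresholdPolicy Ep C) s₀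
              (fun k => A k ω) (fun k => R k ω)) (fun k => J k ω)) atTop (𝓝 (p B))) ∧
      Tendsto p atTop (𝓝 pblk)) ∧
    -- infinite capacity
    (∀ s₀ : PushPolicy.State, 0 ≤ s₀.energy → s₀.pushed ≤ N → ∀ᵐ ω ∂P,
      Tendsto (PushPolicy.blockedRatio (PushPolicy.thresholdPolicy Ep C)
        (PushPolicy.trajectory ⊤ Ep (PushPolicy.thresholdPolicy Ep C) s₀
          (fun k => A k ω) (fun k => R k ω)) (fun k => J k ω)) atTop (𝓝 pblk)) ∧
    -- average power constraint: the threshold `C` is feasible and gives the same value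
    (pc * C / (N + pc) * Ep ≤ Abar ∧
      ∀ s₀ : PushPolicy.State, s₀.pushed ≤ N → ∀ᵐ ω ∂P,
        Tendsto (PushPolicy.averagePower Ep (PushPolicy.unconstrainedPolicy C)
          (PushPolicy.trajectory ⊤ Ep (PushPolicy.unconstrainedPolicy C) s₀
            (fun k => A k ω) (fun k => R k ω))) atTop (𝓝 (pc * C / (N + pc) * Ep)) ∧
        Tendsto (PushPolicy.blockedRatio (PushPolicy.unconstrainedPolicy C)
          (PushPolicy.trajectory ⊤ Ep (PushPolicy.unconstrainedPolicy C) s₀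
            (fun k => A k ω) (fun k => R k ω)) (fun k => J k ω)) atTop (𝓝 pblk)) ∧
    -- and this value is optimal among the feasible thresholds
    IsLeast {b : ℝ | PushPolicy.IsAveragePowerBlocking P N Ep Abar A J R b} pblk := by
  subst hC hpblk
  have hCN := PushPolicy.potbThreshold_le N pc Abar Ep
  have hfeas := PushPolicy.power_potbThreshold_le (N := N) hpc.1 hEp hX.arrival_mean_nonneg
  obtain ⟨p, hp, hlim⟩ := PushPolicy.exists_blocking_tendsto hX hN hpu hpc hCN hEp hfeas
  exact ⟨⟨p, fun B _ s₀ => hp B s₀, hlim⟩,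
    PushPolicy.tendsto_blockedRatio_top hX hN hpu hpc hCN hEp hfeas,
    ⟨hfeas, PushPolicy.tendsto_unconstrained hX hN hpc.1 hCN⟩,
    PushPolicy.isLeast_blockProb hX hN hpu.1 hpc.1 hEp⟩
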